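/- Let $q$ be a real-valued $C^\infty$ function on a neighbourhood of $[0,1]$. Let $\lambda_1<\lambda_2<\cdots$ be the increasing sequence of all eigenvalues of the Dirichlet problem $-y''+qy=\lambda y$ in $\,]0,1[\,$, $y(0)=y(1)=0$, and let $h_1,h_2,\dots$ be associated real eigenfunctions, orthonormal in $L^2(0,1)$. For $n\ge 1$ let $\mathfrak S_n(x_1,\dots,x_n)=\det\big(h_i(x_j)\big)_{1\le i,j\le n}$ be the Slater determinant. For $m\ge1$ let $P_m(y_1,\dots,y_m)=\prod_{1\le i<j\le m}(y_i-y_j)$ (so $P_1=1$) be the Vandermonde polynomial, and let $D_m(\partial_y)=\partial_{y_m}^{m-1}\partial_{y_{m-1}}^{m-2}\cdots\partial_{y_3}^{2}\,\partial_{y_2}$ (so $D_1$ is the identity). Let $p\ge 1$, let $k_1,\dots,k_p$ be positive integers, $n=k_1+\cdots+k_p$, let $0<\bar c_1<\cdots<\bar c_p<1$, and let $c=(\bar c_1,\dots,\bar c_1,\dots,\bar c_p,\dots,\bar c_p)\in\,]0,1[^n$, where $\bar c_j$ is repeated $k_j$ times. Split $\xi\in\mathbb R^n$ accordingly into consecutive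 blocks, $\xi=(\xi^{(1)},\dots,\xi^{(p)})$ with $\xi^{(j)}\in\mathbb R^{k_j}$. Then there is a constant $\rho(c)\neq0$ such that the following hold. (0) There are an integer $d\ge 0$ and a nonzero homogeneous polynomial $\widehat P$ of degree $d$ such that $\mathfrak S_n(c+\xi)=\widehat P(\xi)+O(|\xi|^{d+1})$ as $\xi\to0$. Moreover, let $d\ge0$ and let $\widehat P$ be any nonzero homogeneous polynomial of degree $d$ such that, for every $\xi\in\mathbb R^n$, $\mathfrak S_n(c+t\xi)=\widehat P(t\xi)+O(t^{d+1})$ as $t\to0$. Then $\widehat P$ is harmonic, and: (1) $\widehat P(\sigma\cdot\xi)=\varepsilon(\sigma)\,\widehat P(\xi)$ for every $\xi\in\mathbb R^n$ and every $\sigma=(\sigma_1,\dots,\sigma_p)\in\mathfrak s_{k_1}\times\cdots\times\mathfrak s_{k_p}$, where $\sigma_j$ permutes the entries of $\xi^{(j)}$ and $\varepsilon(\sigma)$ is the signature of $\sigma$ as a permutation of the $n$ coordinates; (2) for every $\xi\in\mathbb R^n$, $\widehat P(\xi)=0$ if and only if $\prod_{j=1}^pP_{k_j}(\xi^{(j)})=0$;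 (3) $\widehat P(\xi)=\rho(c)\,P_{k_1}(\xi^{(1)})\cdots P_{k_p}(\xi^{(p)})$, and $d=\sum_{j=1}^p\frac{k_j(k_j-1)}2$. (4) There is a function $\omega$ with $\omega(\xi)\to0$ as $\xi\to0$ such that, for all $\xi$ with $c+\xi\in\,]0,1[^n$, $$\mathfrak S_n(c+\xi)=\rho(c)\,P_{k_1}(\xi^{(1)})\cdots P_{k_p}(\xi^{(p)})\,\big(1+\omega(\xi)\big).$$ (5) $$D_{k_1}(\partial_{x^{(1)}})\cdots D_{k_p}(\partial_{x^{(p)}})\,\mathfrak S_n(x)\Big|_{x=c}=D_{k_1}(\partial_{\xi^{(1)}})\cdots D_{k_p}(\partial_{\xi^{(p)}})\,\mathfrak S_n(c+\xi)\Big|_{\xi=0}\neq0 .$$ -/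

import Mathlib

open Set Filter Topology Asymptotics
open scoped ContDiff

noncomputable section

/-! ### The Dirichlet Sturm-Liouville problem on `[0,1]` -/

/-- `y` is a (classical, real) eigenfunction for the eigenvalue `μ` of the Dirichlet problem
`-y'' + q y = μ y` in `]0,1[`, `y(0) = y(1) = 0`. The values of `y` outside `[0,1]` are irrelevant. -/
structure IsDirichletEigenpair (q : ℝ → ℝ) (μ : ℝ) (y : ℝ → ℝ) : Prop where
  contDiffOn : ContDiffOn ℝ 2 y (Icc 0 1)
  equation : ∀ x ∈ Ioo (0 : ℝ) 1, -(deriv (deriv y) x) + q x * y x = μ * y x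
  left : y 0 = 0
  right : y 1 = 0
  nontrivial : ∃ x ∈ Ioo (0 : ℝ) 1, y x ≠ 0

/-- `lam 0 < lam 1 < ⋯` is the increasing list of all the Dirichlet eigenvalues, and `h 0, h 1, …`
is an associated `L²(0,1)`-orthonormal sequence of eigenfunctions. The indices start at `0`:
`lam j`, `h j` are what is usually written `λ_{j+1}`, `h_{j+1}`. -/
structure IsDirichletEigenSystem (q : ℝ → ℝ) (lam : ℕ → ℝ) (h : ℕ → ℝ → ℝ) : Prop where
  strictMono : StrictMono lam
  eigenpair : ∀ j, IsDirichletEigenpair q (lam j) (h j)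
  exhaustive : ∀ (μ : ℝ) (y : ℝ → ℝ), IsDirichletEigenpair q μ y → ∃ j, lam j = μ
  orthonormal : ∀ i j, (∫ x in (0 : ℝ)..1, h i x * h j x) = if i = j then 1 else 0

/-- The Slater determinant `𝔖_n(x_1,…,x_n) = det (h_i(x_j))` of the first `n` functions. -/
def slater (h : ℕ → ℝ → ℝ) (n : ℕ) (x : Fin n → ℝ) : ℝ :=
  Matrix.det (Matrix.of fun i j : Fin n => h (i : ℕ) (x j))

/-! ### Block structure -/

/-- The position in `(x_1,…,x_n)`, `n = k_1 + ⋯ + k_p`, of the relabelled variable `x_{j,a}`: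
the blocks follow each other in order, the `j`-th one having `k j` entries. -/
def blockIndex {p : ℕ} (k : Fin p → ℕ) (j : Fin p) (a : Fin (k j)) : Fin (∑ j, k j) :=
  finSigmaFinEquiv ⟨j, a⟩

/-- The `j`-th block `ξ^{(j)}` of the vector `ξ`. -/
def block {p : ℕ} (k : Fin p → ℕ) (ξ : Fin (∑ j, k j) → ℝ) (j : Fin p) : Fin (k j) → ℝ :=
  fun a => ξ (blockIndex k j a)

/-- The vector `(c̄_1,…,c̄_1,…,c̄_p,…,c̄_p)`, with `c̄_j` repeated `k_j` times. -/
def blockPoint {p : ℕ} (k : Fin p → ℕ) (cbar : Fin p → ℝ) : Fin (∑ j, k j) → ℝ :=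
  fun i => cbar (finSigmaFinEquiv.symm i).1

/-- The permutation `σ = (σ_1,…,σ_p)` of the `n` indices, `σ_j` permuting the `j`-th block. -/
def blockPerm {p : ℕ} (k : Fin p → ℕ) (σ : ∀ j, Equiv.Perm (Fin (k j))) :
    Equiv.Perm (Fin (∑ j, k j)) :=
  finSigmaFinEquiv.permCongr (Equiv.Perm.sigmaCongrRight σ)

/-! ### Polynomials -/

/-- The Vandermonde polynomial `P_m = ∏_{i < j} (X_i - X_j)` (so `P_1 = 1`). -/
def vandermondePoly (m : ℕ) : MvPolynomial (Fin m) ℝ :=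
  ∏ i : Fin m, ∏ j ∈ Finset.Ioi i, (MvPolynomial.X i - MvPolynomial.X j)

/-- The polynomial `∏_j P_{k_j}(ξ^{(j)})` in the variables `ξ_1,…,ξ_n`. -/
def blockVandermonde {p : ℕ} (k : Fin p → ℕ) : MvPolynomial (Fin (∑ j, k j)) ℝ :=
  ∏ j, MvPolynomial.rename (blockIndex k j) (vandermondePoly (k j))

/-- `ΔP = 0`. -/
def IsHarmonicPoly {n : ℕ} (P : MvPolynomial (Fin n) ℝ) : Prop :=
  ∑ i, MvPolynomial.pderiv i (MvPolynomial.pderiv i P) = 0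

/-- `P` is a nonzero homogeneous polynomial of degree `d` and `f(c + ξ) = P(ξ) + ω_{d+1}(c, ξ)`,
where, for every `ξ`, `ω_{d+1}(c, t ξ) = O(t^{d+1})` as `t → 0`. -/
structure IsLeadingTerm {n : ℕ} (f : (Fin n → ℝ) → ℝ) (c : Fin n → ℝ) (d : ℕ)
    (P : MvPolynomial (Fin n) ℝ) : Prop where
  homogeneous : P.IsHomogeneous d
  ne_zero : P ≠ 0
  remainder : ∀ ξ : Fin n → ℝ,
    (fun t : ℝ => f (c + t • ξ) - MvPolynomial.eval (t • ξ) P) =O[𝓝 0] fun t : ℝ => t ^ (d + 1)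

/-! ### Differential operators -/

/-- The partial derivative `∂f/∂x_i`. -/
def partialDeriv {n : ℕ} (i : Fin n) (f : (Fin n → ℝ) → ℝ) : (Fin n → ℝ) → ℝ :=
  fun x => lineDeriv ℝ f x (Pi.single i 1)

/-- The operator `D_m = ∂_{y_m}^{m-1} ∂_{y_{m-1}}^{m-2} ⋯ ∂_{y_3}^2 ∂_{y_2}`, where `y_1,…,y_m` are
the variables `x_{e 0},…,x_{e (m-1)}`; the rightmost derivative is applied first. -/
def vandermondeD {n m : ℕ} (e : Fin m → Fin n) (f : (Fin n → ℝ) → ℝ) : (Fin n → ℝ) → ℝ :=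
  (List.finRange m).foldl (fun F a => (partialDeriv (e a))^[(a : ℕ)] F) f

/-- The operator `D_{k_1}(∂_{x^{(1)}}) ⋯ D_{k_p}(∂_{x^{(p)}})`. -/
def blockD {p : ℕ} (k : Fin p → ℕ) (f : (Fin (∑ j, k j) → ℝ) → ℝ) :
    (Fin (∑ j, k j) → ℝ) → ℝ :=
  (List.finRange p).foldr (fun j F => vandermondeD (blockIndex k j) F) f

end

/-! Two facts carry the proof: a factorization of the Slater determinant and the nonvanishing of its
confluent form.

Within each block, Newton interpolation writes the values of `h_i` at the nodes as divided
differences times a triangular matrix whose determinant is the Vandermonde product of that block.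
Hence the determinant is `V(ξ)`, the product of the block Vandermondes, times a determinant of
divided differences (`exists_slater_eq_det_mul`). By the mean value theorem these tend to signed
Taylor coefficients with error `O(|ξ|)`, so `𝔖_n(c + ξ) = V(ξ) (ρ + O(|ξ|))` with `ρ = det
(taylorMatrix)` (`exists_slater_sub_le`). The leading term is therefore `ρ V`, and leading terms are
unique.

If `ρ = 0`, a nontrivial combination of the first `n` eigenfunctions vanishes to order `k_j` at each
`c̄_j`, so it has `n` interior zeros with multiplicity. Sturm's theorem forbids this
(`eq_zero_of_hasZerosMult`). Following Liouville, replacing the coefficients `v_i` by `(λ_0 - λ_i)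
v_i` loses no zeros. After iteration and normalization the combinations converge in `C¹` to the
eigenfunction `h_m` of highest index present, which has at most `m < n` interior zeros. This last
bound (`not_hasZeros`) comes from shooting: each new interior zero of the solution of the initial
value problem enters at an eigenvalue.

Harmonicity holds because the Laplacian preserves antisymmetry in each block and lowers the degree,
while `V` has the least degree possible. The operator in (5) differentiates each column separately
and produces the confluent determinant. -/

noncomputable section

/-! ### Linear second order equations on `[0,1]` -/

/-- `(y, z)` solves `y' = z`, `z' = Q y` on `[0,1]`. -/
structure IsSolPair (Q y z : ℝ → ℝ) : Prop where
  left : ∀ x ∈ Icc (0 : ℝ) 1, HasDerivWithinAt y (z x) (Icc 0 1) x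
  right : ∀ x ∈ Icc (0 : ℝ) 1, HasDerivWithinAt z (Q x * y x) (Icc 0 1) x

theorem HasDerivWithinAt.Ici_of_Icc {E : Type*} [NormedAddCommGroup E] [NormedSpace ℝ E]
    {f : ℝ → E} {f' : E} {a b x : ℝ}
    (h : HasDerivWithinAt f f' (Icc a b) x) (hx : x ∈ Ico a b) :
    HasDerivWithinAt f f' (Ici x) x :=
  h.mono_of_mem_nhdsWithin <| mem_of_superset (Icc_mem_nhdsGE hx.2) (Icc_subset_Icc_left hx.1)

theorem HasDerivWithinAt.Iic_of_Icc {E : Type*} [NormedAddCommGroup E] [NormedSpace ℝ E]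
    {f : ℝ → E} {f' : E} {a b x : ℝ}
    (h : HasDerivWithinAt f f' (Icc a b) x) (hx : x ∈ Ioc a b) :
    HasDerivWithinAt f f' (Iic x) x :=
  h.mono_of_mem_nhdsWithin <| mem_of_superset (Icc_mem_nhdsLE hx.1) (Icc_subset_Icc_right hx.2)

theorem lipschitzWith_companion {r : ℝ} {K : NNReal} (hK : 1 ≤ K) (hr : |r| ≤ K) :
    LipschitzWith K fun p : ℝ × ℝ => (p.2, r * p.1) := by
  refine LipschitzWith.of_dist_le_mul fun p p' => ?_
  have hK' : (1 : ℝ) ≤ K := by exact_mod_cast hK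
  have h1 : dist p.1 p'.1 ≤ dist p p' := le_max_left _ _
  have h2 : dist p.2 p'.2 ≤ dist p p' := le_max_right _ _
  rw [Prod.dist_eq]
  refine max_le ?_ ?_
  · simpa using h2.trans (le_mul_of_one_le_left dist_nonneg hK')
  · simp only [Real.dist_eq] at h1 ⊢
    rw [← mul_sub, abs_mul]
    exact mul_le_mul hr h1 (abs_nonneg _) (by positivity)

namespace IsSolPair

variable {Q y z : ℝ → ℝ}

theorem pair (h : IsSolPair Q y z) {x : ℝ} (hx : x ∈ Icc (0 : ℝ) 1) :
    HasDerivWithinAt (fun t => (y t, z t)) (z x, Q x * y x) (Icc 0 1) x :=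
  (h.left x hx).prodMk (h.right x hx)

theorem continuousOn_pair (h : IsSolPair Q y z) :
    ContinuousOn (fun t => (y t, z t)) (Icc 0 1) :=
  fun _ hx => (h.pair hx).continuousWithinAt

theorem continuousOn_left (h : IsSolPair Q y z) : ContinuousOn y (Icc 0 1) :=
  fun x hx => (h.left x hx).continuousWithinAt

theorem continuousOn_right (h : IsSolPair Q y z) : ContinuousOn z (Icc 0 1) :=
  fun x hx => (h.right x hx).continuousWithinAt

theorem unique (hQ : ContinuousOn Q (Icc 0 1)) {y' z' : ℝ → ℝ} (h : IsSolPair Q y z)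
    (h' : IsSolPair Q y' z') {x₀ : ℝ} (hx₀ : x₀ ∈ Icc (0 : ℝ) 1) (hy : y x₀ = y' x₀)
    (hz : z x₀ = z' x₀) : ∀ x ∈ Icc (0 : ℝ) 1, y x = y' x ∧ z x = z' x := by
  obtain ⟨K, hK⟩ := isCompact_Icc.exists_bound_of_continuousOn hQ
  have hlip : ∀ t ∈ Icc (0 : ℝ) 1, LipschitzOnWith (Real.toNNReal (max K 1))
      (fun p : ℝ × ℝ => (p.2, Q t * p.1)) univ := fun t ht =>
    (lipschitzWith_companion (by simp [Real.le_toNNReal_iff_coe_le])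
      (by simpa using Or.inl (hK t ht))).lipschitzOnWith
  have hl : Icc x₀ 1 ⊆ Icc (0 : ℝ) 1 := Icc_subset_Icc_left hx₀.1
  have hr : Icc 0 x₀ ⊆ Icc (0 : ℝ) 1 := Icc_subset_Icc_right hx₀.2
  have e1 := ODE_solution_unique_of_mem_Icc_right (v := fun t p => (p.2, Q t * p.1))
    (s := fun _ => univ) (a := x₀) (b := 1) (f := fun t => (y t, z t))
    (g := fun t => (y' t, z' t)) (fun t ht => hlip t (hl (Ico_subset_Icc_self ht)))
    (h.continuousOn_pair.mono hl)
    (fun t ht => (h.pair (hl (Ico_subset_Icc_self ht))).Ici_of_Icc ⟨hx₀.1.trans ht.1, ht.2⟩)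
    (fun _ _ => trivial) (h'.continuousOn_pair.mono hl)
    (fun t ht => (h'.pair (hl (Ico_subset_Icc_self ht))).Ici_of_Icc ⟨hx₀.1.trans ht.1, ht.2⟩)
    (fun _ _ => trivial) (by simp [hy, hz])
  have e2 := ODE_solution_unique_of_mem_Icc_left (v := fun t p => (p.2, Q t * p.1))
    (s := fun _ => univ) (a := 0) (b := x₀) (f := fun t => (y t, z t))
    (g := fun t => (y' t, z' t)) (fun t ht => hlip t (hr (Ioc_subset_Icc_self ht)))
    (h.continuousOn_pair.mono hr)
    (fun t ht => (h.pair (hr (Ioc_subset_Icc_self ht))).Iic_of_Icc ⟨ht.1, ht.2.trans hx₀.2⟩)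
    (fun _ _ => trivial) (h'.continuousOn_pair.mono hr)
    (fun t ht => (h'.pair (hr (Ioc_subset_Icc_self ht))).Iic_of_Icc ⟨ht.1, ht.2.trans hx₀.2⟩)
    (fun _ _ => trivial) (by simp [hy, hz])
  intro x hx
  rcases le_total x x₀ with hxx | hxx
  · simpa using e2 ⟨hx.1, hxx⟩
  · simpa using e1 ⟨hxx, hx.2⟩

theorem const_mul (h : IsSolPair Q y z) (a : ℝ) :
    IsSolPair Q (fun x => a * y x) (fun x => a * z x) where
  left x hx := (h.left x hx).const_mul a
  right x hx := ((h.right x hx).const_mul a).congr_deriv (by ring)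

theorem zero (Q : ℝ → ℝ) : IsSolPair Q (fun _ => 0) (fun _ => 0) where
  left x _ := hasDerivWithinAt_const x _ 0
  right x _ := by simpa using hasDerivWithinAt_const x (Icc (0 : ℝ) 1) (0 : ℝ)

/-- A nontrivial solution has no double zeros. -/
theorem no_double_zero (hQ : ContinuousOn Q (Icc 0 1)) (h : IsSolPair Q y z) (hz : z 0 ≠ 0) :
    ∀ x ∈ Icc (0 : ℝ) 1, ¬ (y x = 0 ∧ z x = 0) := fun _ hx ⟨h1, h2⟩ =>
  hz (h.unique hQ (zero Q) hx h1 h2 0 (by simp)).2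

end IsSolPair

theorem abs_max_min_sub_le (R a b : ℝ) :
    |max (-R) (min R a) - max (-R) (min R b)| ≤ |a - b| := by
  have h1 := abs_max_sub_max_le_abs (min R a) (min R b) (-R)
  have h2 := abs_min_sub_min_le_max R a R b
  rw [max_comm, max_comm (-R) (min R b)]
  refine h1.trans (h2.trans ?_)
  simp

/-- Global existence for `y'' = Q y`, `y(0) = 0`, `y'(0) = 1`. -/
theorem exists_isSolPair {Q : ℝ → ℝ} (hQ : ContinuousOn Q (Icc 0 1)) :
    ∃ y z, IsSolPair Q y z ∧ y 0 = 0 ∧ z 0 = 1 := by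
  obtain ⟨K₀, hK₀⟩ := isCompact_Icc.exists_bound_of_continuousOn hQ
  obtain ⟨K, hK1, hK⟩ : ∃ K : ℝ, 1 ≤ K ∧ ∀ x ∈ Icc (0 : ℝ) 1, |Q x| ≤ K :=
    ⟨max K₀ 1, le_max_right _ _, fun x hx => (hK₀ x hx).trans (le_max_left _ _)⟩
  -- Grönwall bounds a solution with initial norm `1` by `exp K` on `[0,1]`. Truncating the field at
  -- level `R` makes it bounded, so Picard–Lindelöf applies on all of `[0,1]` at once; the solution
  -- found never feels the truncation.
  set R : ℝ := Real.exp K with hR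
  have hR0 : 0 < R := Real.exp_pos _
  set τ : ℝ → ℝ := fun a => max (-R) (min R a) with hτ
  have hτlip : ∀ a b, |τ a - τ b| ≤ |a - b| := abs_max_min_sub_le R
  have hτle : ∀ a, |τ a| ≤ R := fun a => abs_le.2
    ⟨le_max_left _ _, max_le (by linarith) (min_le_left _ _)⟩
  have hτ0 : τ 0 = 0 := by simp [hτ, hR0.le]
  have hτabs : ∀ a, |τ a| ≤ |a| := fun a => by simpa [hτ0] using hτlip a 0
  have hτid : ∀ a, |a| ≤ R → τ a = a := fun a ha => by
    simp only [hτ]; rw [min_eq_right (abs_le.1 ha).2, max_eq_right (abs_le.1 ha).1]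
  let v : ℝ → ℝ × ℝ → ℝ × ℝ := fun t p => (τ p.2, Q t * τ p.1)
  have hPL : IsPicardLindelof v (tmin := 0) (tmax := 1) ⟨0, by simp⟩ ((0, 1) : ℝ × ℝ)
      (Real.toNNReal (K * R)) 0 (Real.toNNReal (K * R)) (Real.toNNReal K) := by
    refine ⟨fun t ht => ?_, fun p _ => ?_, fun t ht p _ => ?_, ?_⟩
    · refine (LipschitzWith.of_dist_le_mul fun p p' => ?_).lipschitzOnWith
      rw [Real.coe_toNNReal _ (by linarith), Prod.dist_eq]
      have h1 : |p.1 - p'.1| ≤ dist p p' := le_max_left _ _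
      have h2 : |p.2 - p'.2| ≤ dist p p' := le_max_right _ _
      refine max_le ?_ ?_
      · exact ((hτlip _ _).trans h2).trans (le_mul_of_one_le_left dist_nonneg hK1)
      · simp only [Real.dist_eq, v]
        rw [← mul_sub, abs_mul]
        exact mul_le_mul (hK t ht) ((hτlip _ _).trans h1) (abs_nonneg _) (by positivity)
    · exact continuousOn_const.prodMk (hQ.mul continuousOn_const)
    · rw [Real.coe_toNNReal _ (by positivity)]
      refine max_le ?_ ?_
      · exact (hτle _).trans (le_mul_of_one_le_left hR0.le hK1)
      · simp only [Real.norm_eq_abs, v, abs_mul]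
        exact mul_le_mul (hK t ht) (hτle _) (abs_nonneg _) (by positivity)
    · simp
  obtain ⟨α, h0, hα⟩ := hPL.exists_eq_forall_mem_Icc_hasDerivWithinAt₀
  have h0' : α 0 = (0, 1) := h0
  -- Since `|τ a| ≤ |a|`, the truncated field still has norm at most `K ‖α‖`.
  have hbound : ∀ x ∈ Icc (0 : ℝ) 1, ‖α x‖ ≤ R := by
    intro x hx
    have := norm_le_gronwallBound_of_norm_deriv_right_le (K := K) (ε := 0) (δ := 1)
      (fun t ht => (hα t ht).continuousWithinAt)
      (fun t ht => (hα t (Ico_subset_Icc_self ht)).Ici_of_Icc ht) (by simp [h0'])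
      (fun t ht => by
        have h1 : |(α t).1| ≤ ‖α t‖ := le_max_left _ _
        have h2 : |(α t).2| ≤ ‖α t‖ := le_max_right _ _
        rw [add_zero]
        refine max_le ?_ ?_
        · exact ((hτabs _).trans h2).trans (le_mul_of_one_le_left (norm_nonneg _) hK1)
        · simp only [Real.norm_eq_abs, v, abs_mul]
          exact mul_le_mul (hK t (Ico_subset_Icc_self ht)) ((hτabs _).trans h1) (abs_nonneg _)
            (by positivity)) x hx
    rw [gronwallBound_ε0, one_mul] at this
    refine this.trans (Real.exp_le_exp.2 ?_)
    nlinarith [hx.1, hx.2]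
  refine ⟨fun t => (α t).1, fun t => (α t).2, ⟨fun x hx => ?_, fun x hx => ?_⟩, by simp [h0'],
    by simp [h0']⟩
  · have h2 : |(α x).2| ≤ R := (le_max_right _ _).trans (hbound x hx)
    have := (hasFDerivAt_fst (𝕜 := ℝ) (p := α x)).comp_hasDerivWithinAt x (hα x hx)
    simpa [v, hτid _ h2, Function.comp_def] using this
  · have h1 : |(α x).1| ≤ R := (le_max_left _ _).trans (hbound x hx)
    have := (hasFDerivAt_snd (𝕜 := ℝ) (p := α x)).comp_hasDerivWithinAt x (hα x hx)
    simpa [v, hτid _ h1, Function.comp_def] using this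

/-- Continuous dependence of solutions on the coefficient. -/
theorem IsSolPair.dist_le {Q Q' y z y' z' : ℝ → ℝ} {K ε : ℝ} (h : IsSolPair Q y z)
    (h' : IsSolPair Q' y' z') (h0 : y 0 = y' 0) (h1 : z 0 = z' 0) (hK : 1 ≤ K)
    (hQ : ∀ x ∈ Icc (0 : ℝ) 1, |Q x| ≤ K)
    (hε : ∀ x ∈ Icc (0 : ℝ) 1, |Q' x - Q x| * |y' x| ≤ ε) (hε0 : 0 ≤ ε) :
    ∀ x ∈ Icc (0 : ℝ) 1, dist (y x, z x) (y' x, z' x) ≤ gronwallBound 0 K ε 1 := by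
  intro x hx
  have := norm_le_gronwallBound_of_norm_deriv_right_le (K := K) (ε := ε) (δ := 0)
    (f := fun t => (y t, z t) - (y' t, z' t)) (h.continuousOn_pair.sub h'.continuousOn_pair)
    (fun t ht => ((h.pair (Ico_subset_Icc_self ht)).sub
      (h'.pair (Ico_subset_Icc_self ht))).Ici_of_Icc ht) (by simp [h0, h1])
    (fun t ht => by
      have ht' := Ico_subset_Icc_self ht
      have a1 : |y t - y' t| ≤ ‖(y t, z t) - (y' t, z' t)‖ := le_max_left _ _
      have a2 : |z t - z' t| ≤ ‖(y t, z t) - (y' t, z' t)‖ := le_max_right _ _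
      refine max_le ?_ ?_
      · exact (a2.trans (le_mul_of_one_le_left (norm_nonneg _) hK)).trans
          (le_add_of_nonneg_right hε0)
      · have e : Q t * y t - Q' t * y' t = Q t * (y t - y' t) - (Q' t - Q t) * y' t := by ring
        change |Q t * y t - Q' t * y' t| ≤ _
        rw [e]
        refine (abs_sub _ _).trans ?_
        rw [abs_mul, abs_mul]
        exact add_le_add (mul_le_mul (hQ t ht') a1 (abs_nonneg _) (by positivity)) (hε t ht'))
    x hx
  rw [dist_eq_norm]
  refine this.trans (gronwallBound_mono le_rfl hε0 (by linarith) ?_)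
  simpa using hx.2

/-! ### Limits of zeros -/

/-- `f` has at least `N` distinct zeros in `S`. -/
def HasZeros (f : ℝ → ℝ) (S : Set ℝ) (N : ℕ) : Prop :=
  ∃ s : Finset ℝ, ↑s ⊆ S ∧ s.card = N ∧ ∀ x ∈ s, f x = 0

theorem HasZeros.of_le_card {f : ℝ → ℝ} {S : Set ℝ} {N : ℕ} {s : Finset ℝ} (hs : ↑s ⊆ S)
    (hN : N ≤ s.card) (h0 : ∀ x ∈ s, f x = 0) : HasZeros f S N := by
  obtain ⟨t, hts, ht⟩ := Finset.exists_subset_card_eq hN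
  exact ⟨t, fun x hx => hs (hts hx), ht, fun x hx => h0 x (hts hx)⟩

theorem HasZeros.mono {f : ℝ → ℝ} {S : Set ℝ} {N M : ℕ} (h : HasZeros f S N) (hM : M ≤ N) :
    HasZeros f S M := by
  obtain ⟨s, hs, hc, h0⟩ := h
  exact .of_le_card hs (hc ▸ hM) h0

theorem HasZeros.congr {f g : ℝ → ℝ} {S : Set ℝ} {N : ℕ} (h : HasZeros f S N)
    (hfg : ∀ x ∈ S, f x = 0 → g x = 0) : HasZeros g S N := by
  obtain ⟨s, hs, hc, h0⟩ := h
  exact ⟨s, hs, hc, fun x hx => hfg x (hs hx) (h0 x hx)⟩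

/-- Limits of zeros are taken in the compact interval. Endpoint zeros are added before the limit and
removed after it, so that interior zeros drifting to an endpoint are accounted for. -/
theorem HasZeros.Icc_of_Ioo {f : ℝ → ℝ} {N : ℕ} (h : HasZeros f (Ioo 0 1) N) (h0 : f 0 = 0) :
    HasZeros f (Icc 0 1) (N + 1) := by
  obtain ⟨s, hs, hc, hz⟩ := h
  have h0s : (0 : ℝ) ∉ s := fun h => lt_irrefl _ (hs h).1
  refine ⟨insert 0 s, ?_, by rw [Finset.card_insert_of_notMem h0s, hc], ?_⟩
  · intro x hx
    rcases Finset.mem_insert.1 (Finset.mem_coe.1 hx) with rfl | hx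
    · simp
    · exact Ioo_subset_Icc_self (hs hx)
  · simpa [h0] using hz

theorem HasZeros.Icc_of_Ioo' {f : ℝ → ℝ} {N : ℕ} (h : HasZeros f (Ioo 0 1) N) (h0 : f 0 = 0)
    (h1 : f 1 = 0) : HasZeros f (Icc 0 1) (N + 2) := by
  obtain ⟨s, hs, hc, hz⟩ := h
  have h0s : (0 : ℝ) ∉ insert (1 : ℝ) s := fun h => by
    rcases Finset.mem_insert.1 h with h | h
    · exact zero_ne_one h
    · exact lt_irrefl _ (hs h).1
  have h1s : (1 : ℝ) ∉ s := fun h => lt_irrefl _ (hs h).2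
  refine ⟨insert 0 (insert 1 s), ?_, by
    rw [Finset.card_insert_of_notMem h0s, Finset.card_insert_of_notMem h1s, hc], ?_⟩
  · intro x hx
    simp only [Finset.coe_insert, mem_insert_iff] at hx
    rcases hx with rfl | rfl | hx
    · simp
    · simp
    · exact Ioo_subset_Icc_self (hs hx)
  · simpa [h0, h1] using hz

theorem HasZeros.Ioo_of_Icc {f : ℝ → ℝ} {N : ℕ} (h : HasZeros f (Icc 0 1) (N + 2)) :
    HasZeros f (Ioo 0 1) N := by
  obtain ⟨s, hs, hc, hz⟩ := h
  refine .of_le_card (s := (s.erase 0).erase 1) ?_ ?_ ?_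
  · intro x hx
    simp only [Finset.coe_erase, Set.mem_sdiff, Finset.mem_coe, mem_singleton_iff] at hx
    exact ⟨lt_of_le_of_ne (hs hx.1.1).1 (Ne.symm hx.1.2), lt_of_le_of_ne (hs hx.1.1).2 hx.2⟩
  · have h1 := Finset.pred_card_le_card_erase (s := s) (a := 0)
    have h2 := Finset.pred_card_le_card_erase (s := s.erase 0) (a := 1)
    omega
  · exact fun x hx => hz x (Finset.mem_of_mem_erase (Finset.mem_of_mem_erase hx))

theorem HasZeros.Ioo_of_Icc_of_ne {f : ℝ → ℝ} {N : ℕ} (h : HasZeros f (Icc 0 1) (N + 1))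
    (h1 : f 1 ≠ 0) : HasZeros f (Ioo 0 1) N := by
  obtain ⟨s, hs, hc, hz⟩ := h
  refine .of_le_card (s := s.erase 0) ?_ ?_ ?_
  · intro x hx
    simp only [Finset.coe_erase, Set.mem_sdiff, Finset.mem_coe, mem_singleton_iff] at hx
    refine ⟨lt_of_le_of_ne (hs hx.1).1 (Ne.symm hx.2), lt_of_le_of_ne (hs hx.1).2 ?_⟩
    rintro rfl
    exact h1 (hz _ hx.1)
  · have h1 := Finset.pred_card_le_card_erase (s := s) (a := 0)
    omega
  · exact fun x hx => hz x (Finset.mem_of_mem_erase hx)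

theorem eq_zero_of_tendstoUniformlyOn {f : ℝ → ℝ} {F : ℕ → ℝ → ℝ} {S : Set ℝ}
    (hf : ContinuousOn f S) (hF : TendstoUniformlyOn F f atTop S) {φ : ℕ → ℕ} (hφ : StrictMono φ)
    {u : ℕ → ℝ} {a : ℝ} (hu : ∀ n, u n ∈ S) (ha : a ∈ S) (hua : Tendsto u atTop (𝓝 a))
    (h0 : ∀ n, F (φ n) (u n) = 0) : f a = 0 := by
  have hFφ : TendstoUniformlyOn (fun n => F (φ n)) f atTop S := fun v hv =>
    hφ.tendsto_atTop.eventually (hF v hv)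
  have := hFφ.tendstoLocallyUniformlyOn.tendsto_comp (hf a ha) ha
    (tendsto_nhdsWithin_iff.2 ⟨hua, .of_forall hu⟩)
  exact tendsto_nhds_unique this (by simp [h0])

/-- By compactness the ordered `N`-tuples of zeros converge along a subsequence. Two of them cannot
merge: Rolle would place a zero of `G n` between them, and the common limit would be a double zero.
-/
theorem HasZeros.of_tendstoUniformlyOn {f g : ℝ → ℝ} {F G : ℕ → ℝ → ℝ}
    (hFG : ∀ n, ∀ x ∈ Icc (0 : ℝ) 1, HasDerivWithinAt (F n) (G n x) (Icc 0 1) x)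
    (hf : ContinuousOn f (Icc 0 1)) (hg : ContinuousOn g (Icc 0 1))
    (hF : TendstoUniformlyOn F f atTop (Icc 0 1)) (hG : TendstoUniformlyOn G g atTop (Icc 0 1))
    (hfg : ∀ x ∈ Icc (0 : ℝ) 1, ¬ (f x = 0 ∧ g x = 0)) {N : ℕ}
    (hN : ∀ n, HasZeros (F n) (Icc 0 1) N) : HasZeros f (Icc 0 1) N := by
  choose s hs hc h0 using hN
  let x : ℕ → Fin N → ℝ := fun n i => (s n).orderEmbOfFin (hc n) i
  have hxs : ∀ n i, x n i ∈ s n := fun n i => Finset.orderEmbOfFin_mem _ _ _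
  have hx : ∀ n, x n ∈ Set.pi univ fun _ : Fin N => Icc (0 : ℝ) 1 := fun n i _ => hs n (hxs n i)
  have hmono : ∀ n, StrictMono (x n) := fun n => ((s n).orderEmbOfFin (hc n)).strictMono
  obtain ⟨a, ha, φ, hφ, hlim⟩ :=
    (isCompact_univ_pi fun _ : Fin N => isCompact_Icc (a := (0 : ℝ)) (b := 1)).tendsto_subseq hx
  have hlim' : ∀ i, Tendsto (fun n => x (φ n) i) atTop (𝓝 (a i)) := tendsto_pi_nhds.1 hlim
  have hfa : ∀ i, f (a i) = 0 := fun i =>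
    eq_zero_of_tendstoUniformlyOn hf hF hφ (fun n => hs _ (hxs (φ n) i)) (ha i trivial) (hlim' i)
      fun n => h0 _ _ (hxs (φ n) i)
  have hne : ∀ i j, i < j → a i ≠ a j := by
    intro i j hij heq
    have key : ∀ n, ∃ w ∈ Ioo (x (φ n) i) (x (φ n) j), G (φ n) w = 0 := fun n => by
      have hi := hs _ (hxs (φ n) i)
      have hj := hs _ (hxs (φ n) j)
      have hsub : Icc (x (φ n) i) (x (φ n) j) ⊆ Icc 0 1 := Icc_subset_Icc hi.1 hj.2
      refine exists_hasDerivAt_eq_zero (f := F (φ n)) (hmono _ hij)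
        (fun y hy => ((hFG _ y (hsub hy)).continuousWithinAt).mono hsub)
        (by rw [h0 _ _ (hxs _ _), h0 _ _ (hxs _ _)]) fun y hy => ?_
      exact (hFG _ y (hsub (Ioo_subset_Icc_self hy))).hasDerivAt
        (Icc_mem_nhds (hi.1.trans_lt hy.1) (hy.2.trans_le hj.2))
    choose w hw hGw using key
    have hwlim : Tendsto w atTop (𝓝 (a i)) :=
      tendsto_of_tendsto_of_tendsto_of_le_of_le (hlim' i) (heq ▸ hlim' j) (fun n => (hw n).1.le)
        fun n => (hw n).2.le
    exact hfg (a i) (ha i trivial) ⟨hfa i, eq_zero_of_tendstoUniformlyOn hg hG hφ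
      (fun n => ⟨(hs _ (hxs (φ n) i)).1.trans (hw n).1.le,
        (hw n).2.le.trans (hs _ (hxs (φ n) j)).2⟩) (ha i trivial) hwlim hGw⟩
  have hinj : Function.Injective a := fun i j hij => by
    rcases lt_trichotomy i j with h | h | h
    · exact absurd hij (hne _ _ h)
    · exact h
    · exact absurd hij.symm (hne _ _ h)
  refine ⟨Finset.univ.image a, ?_, ?_, ?_⟩
  · intro y hy
    obtain ⟨i, _, rfl⟩ := Finset.mem_image.1 (Finset.mem_coe.1 hy)
    exact ha i trivial
  · rw [Finset.card_image_of_injective _ hinj, Finset.card_fin]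
  · intro y hy
    obtain ⟨i, _, rfl⟩ := Finset.mem_image.1 hy
    exact hfa i

/-- Otherwise double zeros would accumulate at a double zero of the limit. -/
theorem eventually_no_double_zero {f g : ℝ → ℝ} {F G : ℕ → ℝ → ℝ}
    (hf : ContinuousOn f (Icc 0 1)) (hg : ContinuousOn g (Icc 0 1))
    (hF : TendstoUniformlyOn F f atTop (Icc 0 1)) (hG : TendstoUniformlyOn G g atTop (Icc 0 1))
    (hfg : ∀ x ∈ Icc (0 : ℝ) 1, ¬ (f x = 0 ∧ g x = 0)) :
    ∀ᶠ n in atTop, ∀ x ∈ Icc (0 : ℝ) 1, ¬ (F n x = 0 ∧ G n x = 0) := by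
  by_contra hcon
  obtain ⟨φ, hφ, hbad⟩ := extraction_of_frequently_atTop (not_eventually.1 hcon)
  push Not at hbad
  choose x hx h0 using hbad
  obtain ⟨a, ha, ψ, hψ, hlim⟩ := isCompact_Icc.tendsto_subseq hx
  exact hfg a ha ⟨eq_zero_of_tendstoUniformlyOn hf hF (hφ.comp hψ) (fun n => hx (ψ n)) ha hlim
    fun n => (h0 (ψ n)).1, eq_zero_of_tendstoUniformlyOn hg hG (hφ.comp hψ) (fun n => hx (ψ n)) ha
    hlim fun n => (h0 (ψ n)).2⟩

/-- A simple zero persists under small uniform perturbations. -/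
theorem eventually_exists_zero {ι : Type*} {l : Filter ι} {f : ℝ → ℝ} {f' z : ℝ}
    {F : ι → ℝ → ℝ} {V : Set ℝ} (hV : V ∈ 𝓝 z) (hf : HasDerivAt f f' z) (hz : f z = 0)
    (hf' : f' ≠ 0) (hF : ∀ i, ContinuousOn (F i) V)
    (hlim : ∀ x ∈ V, Tendsto (fun i => F i x) l (𝓝 (f x))) :
    ∀ᶠ i in l, ∃ w ∈ V, F i w = 0 := by
  obtain ⟨δ, hδ, hball⟩ := Metric.mem_nhds_iff.1 hV
  -- Multiplying by `f'` treats both signs of the derivative together: `f' * f` goes from negative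
  -- to positive at `z`.
  have hslope : ∀ᶠ x in 𝓝[≠] z, 0 < f' * slope f z x := by
    have := (hasDerivAt_iff_tendsto_slope.1 hf).const_mul f'
    exact this.eventually (lt_mem_nhds (mul_self_pos.2 hf'))
  have hr : ∀ᶠ x in 𝓝[>] z, 0 < f' * slope f z x :=
    hslope.filter_mono (nhdsWithin_mono _ fun x hx => ne_of_gt hx)
  have hl : ∀ᶠ x in 𝓝[<] z, 0 < f' * slope f z x :=
    hslope.filter_mono (nhdsWithin_mono _ fun x hx => ne_of_lt hx)
  obtain ⟨b, hb, hzb, hbδ⟩ := (hr.and (Ioo_mem_nhdsGT (show z < z + δ by linarith))).exists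
  obtain ⟨a, ha, haδ, haz⟩ := (hl.and (Ioo_mem_nhdsLT (show z - δ < z by linarith))).exists
  have hab : Icc a b ⊆ V := fun x hx => hball <| by
    rw [Real.ball_eq_Ioo]; exact ⟨haδ.trans_le hx.1, hx.2.trans_lt hbδ⟩
  have hfb : 0 < f' * f b := by
    have e : f' * f b = (b - z) * (f' * slope f z b) := by
      rw [slope_def_field, hz]; field_simp [sub_ne_zero.2 hzb.ne']; ring
    rw [e]; exact mul_pos (sub_pos.2 hzb) hb
  have hfa : f' * f a < 0 := by
    have e : f' * f a = (a - z) * (f' * slope f z a) := by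
      rw [slope_def_field, hz]; field_simp [sub_ne_zero.2 haz.ne]; ring
    rw [e]; exact mul_neg_of_neg_of_pos (sub_neg.2 haz) ha
  have hle : a ≤ b := haz.le.trans hzb.le
  filter_upwards [((hlim a (hab ⟨le_rfl, hle⟩)).const_mul f').eventually (gt_mem_nhds hfa),
    ((hlim b (hab ⟨hle, le_rfl⟩)).const_mul f').eventually (lt_mem_nhds hfb)] with i hia hib
  obtain ⟨w, hw, hw0⟩ := intermediate_value_Icc hle
    (f := fun x => f' * F i x) (continuousOn_const.mul ((hF i).mono hab)) ⟨hia.le, hib.le⟩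
  exact ⟨w, hab hw, (mul_eq_zero.1 hw0).resolve_left hf'⟩

/-- Each simple zero persists inside its own neighbourhood, and these neighbourhoods are chosen
disjoint, so no two of the new zeros coincide. -/
theorem HasZeros.eventually {ι : Type*} {l : Filter ι} {f g : ℝ → ℝ} {F : ι → ℝ → ℝ} {N : ℕ}
    (hfg : ∀ x ∈ Ioo (0 : ℝ) 1, HasDerivAt f (g x) x)
    (h0 : ∀ x ∈ Ioo (0 : ℝ) 1, ¬ (f x = 0 ∧ g x = 0))
    (hF : ∀ i, ContinuousOn (F i) (Ioo 0 1))
    (hlim : ∀ x ∈ Ioo (0 : ℝ) 1, Tendsto (fun i => F i x) l (𝓝 (f x)))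
    (h : HasZeros f (Ioo 0 1) N) : ∀ᶠ i in l, HasZeros (F i) (Ioo 0 1) N := by
  obtain ⟨s, hs, hc, hz⟩ := h
  obtain ⟨U, hU, hdisj⟩ := s.finite_toSet.t2_separation
  have : ∀ᶠ i in l, ∀ z ∈ s, ∃ w ∈ U z ∩ Ioo 0 1, F i w = 0 := by
    rw [Finset.eventually_all]
    intro z hzs
    refine eventually_exists_zero (f := f) (f' := g z)
      (inter_mem ((hU z).2.mem_nhds (hU z).1) (Ioo_mem_nhds (hs hzs).1 (hs hzs).2))
      (hfg z (hs hzs)) (hz z hzs) (fun h => h0 z (hs hzs) ⟨hz z hzs, h⟩)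
      (fun i => (hF i).mono inter_subset_right) fun x hx => hlim x hx.2
  filter_upwards [this] with i hi
  choose! w hw hw0 using hi
  refine ⟨s.image w, ?_, ?_, ?_⟩
  · intro y hy
    obtain ⟨z, hz, rfl⟩ := Finset.mem_image.1 (Finset.mem_coe.1 hy)
    exact (hw z hz).2
  · rw [Finset.card_image_of_injOn, hc]
    intro z hz z' hz' heq
    by_contra hne
    exact (Set.disjoint_left.1 (hdisj hz hz' hne)) (hw z hz).1 (heq ▸ (hw z' hz').1)
  · intro y hy
    obtain ⟨z, hz, rfl⟩ := Finset.mem_image.1 hy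
    exact hw0 z hz

/-! ### Eigenfunctions as solutions of the initial value problem -/

theorem closure_Ioo_zero_one : closure (Ioo (0 : ℝ) 1) = Icc 0 1 := closure_Ioo zero_ne_one

theorem derivWithin_Icc_eqOn_deriv (f : ℝ → ℝ) :
    EqOn (derivWithin f (Icc 0 1)) (deriv f) (Ioo 0 1) := fun _ hx =>
  derivWithin_of_mem_nhds (Icc_mem_nhds hx.1 hx.2)

/-- The equation extends to the endpoints by continuity, which turns an eigenfunction into a
solution of an initial value problem at `0`. -/
theorem IsDirichletEigenpair.isSolPair {q y : ℝ → ℝ} {μ : ℝ} (hq : ContinuousOn q (Icc 0 1))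
    (h : IsDirichletEigenpair q μ y) :
    IsSolPair (fun x => q x - μ) y (derivWithin y (Icc 0 1)) := by
  have hu : UniqueDiffOn ℝ (Icc (0 : ℝ) 1) := uniqueDiffOn_Icc zero_lt_one
  have hd : DifferentiableOn ℝ y (Icc 0 1) := h.contDiffOn.differentiableOn two_ne_zero
  have h1 : ContDiffOn ℝ 1 (derivWithin y (Icc 0 1)) (Icc 0 1) :=
    h.contDiffOn.derivWithin hu (by norm_num)
  have hd1 := h1.differentiableOn one_ne_zero
  have heq : EqOn (derivWithin (derivWithin y (Icc 0 1)) (Icc 0 1)) (fun x => (q x - μ) * y x)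
      (Icc 0 1) := by
    refine EqOn.of_subset_closure (s := Ioo 0 1) ?_ (h1.continuousOn_derivWithin hu le_rfl)
      ((hq.sub continuousOn_const).mul h.contDiffOn.continuousOn) Ioo_subset_Icc_self
      closure_Ioo_zero_one.ge
    intro x hx
    rw [derivWithin_Icc_eqOn_deriv _ hx]
    have : derivWithin y (Icc 0 1) =ᶠ[𝓝 x] deriv y :=
      (derivWithin_Icc_eqOn_deriv y).eventuallyEq_of_mem (Ioo_mem_nhds hx.1 hx.2)
    rw [this.deriv_eq]
    linarith [h.equation x hx]
  refine ⟨fun x hx => (hd x hx).hasDerivWithinAt, fun x hx => ?_⟩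
  exact (hd1 x hx).hasDerivWithinAt.congr_deriv (heq hx)

theorem IsSolPair.isDirichletEigenpair {q y z : ℝ → ℝ} {μ : ℝ} (hq : ContinuousOn q (Icc 0 1))
    (h : IsSolPair (fun x => q x - μ) y z) (h0 : y 0 = 0) (h1 : y 1 = 0) (hz : z 0 ≠ 0) :
    IsDirichletEigenpair q μ y := by
  have hu : UniqueDiffOn ℝ (Icc (0 : ℝ) 1) := uniqueDiffOn_Icc zero_lt_one
  have hQ : ContinuousOn (fun x => q x - μ) (Icc 0 1) := hq.sub continuousOn_const
  have hy : ∀ x ∈ Ioo (0 : ℝ) 1, HasDerivAt y (z x) x := fun x hx =>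
    (h.left x (Ioo_subset_Icc_self hx)).hasDerivAt (Icc_mem_nhds hx.1 hx.2)
  have hz' : ∀ x ∈ Ioo (0 : ℝ) 1, HasDerivAt z ((q x - μ) * y x) x := fun x hx =>
    (h.right x (Ioo_subset_Icc_self hx)).hasDerivAt (Icc_mem_nhds hx.1 hx.2)
  have hcz : ContDiffOn ℝ 1 z (Icc 0 1) := by
    rw [show (1 : WithTop ℕ∞) = 0 + 1 by norm_num, contDiffOn_succ_iff_derivWithin hu]
    refine ⟨fun x hx => (h.right x hx).differentiableWithinAt, by simp, ?_⟩
    rw [contDiffOn_zero]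
    exact (hQ.mul h.continuousOn_left).congr fun x hx => (h.right x hx).derivWithin (hu x hx)
  refine ⟨?_, fun x hx => ?_, h0, h1, ?_⟩
  · rw [show (2 : WithTop ℕ∞) = 1 + 1 by norm_num, contDiffOn_succ_iff_derivWithin hu]
    refine ⟨fun x hx => (h.left x hx).differentiableWithinAt, by simp, ?_⟩
    exact hcz.congr fun x hx => (h.left x hx).derivWithin (hu x hx)
  · have : deriv y =ᶠ[𝓝 x] z := by
      filter_upwards [Ioo_mem_nhds hx.1 hx.2] with t ht using (hy t ht).deriv
    rw [this.deriv_eq, (hz' x hx).deriv]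
    ring
  · by_contra hcon
    push Not at hcon
    have hhalf : (1 / 2 : ℝ) ∈ Ioo (0 : ℝ) 1 := by norm_num
    have hzero : y =ᶠ[𝓝 (1 / 2 : ℝ)] fun _ => 0 := by
      filter_upwards [Ioo_mem_nhds hhalf.1 hhalf.2] with t ht using hcon t ht
    have : z (1 / 2) = 0 := by
      rw [← (hy _ hhalf).deriv, hzero.deriv_eq, deriv_const]
    exact h.no_double_zero hQ hz _ (Ioo_subset_Icc_self hhalf) ⟨hcon _ hhalf, this⟩

theorem IsDirichletEigenpair.derivWithin_zero_ne {q y : ℝ → ℝ} {μ : ℝ}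
    (hq : ContinuousOn q (Icc 0 1)) (h : IsDirichletEigenpair q μ y) :
    derivWithin y (Icc 0 1) 0 ≠ 0 := fun h0 => by
  obtain ⟨x, hx, hne⟩ := h.nontrivial
  exact hne ((h.isSolPair hq).unique (hq.sub continuousOn_const) (IsSolPair.zero _) (x₀ := 0)
    (by simp) h.left h0 x (Ioo_subset_Icc_self hx)).1

/-- `Y μ`, `Z μ` is the solution of `y'' = (q - μ) y`, `y(0) = 0`, `y'(0) = 1`, and its
derivative. -/
structure IsShooting (q : ℝ → ℝ) (Y Z : ℝ → ℝ → ℝ) : Prop where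
  isSolPair : ∀ μ, IsSolPair (fun x => q x - μ) (Y μ) (Z μ)
  left : ∀ μ, Y μ 0 = 0
  right : ∀ μ, Z μ 0 = 1

theorem exists_isShooting {q : ℝ → ℝ} (hq : ContinuousOn q (Icc 0 1)) :
    ∃ Y Z, IsShooting q Y Z := by
  have := fun μ : ℝ => exists_isSolPair (hq.sub (continuousOn_const (c := μ)))
  choose Y Z h h0 h1 using this
  exact ⟨Y, Z, h, h0, h1⟩

/-! ### Zeros of the shooting solution as the spectral parameter varies -/

namespace IsShooting

variable {q : ℝ → ℝ} {Y Z : ℝ → ℝ → ℝ}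

theorem no_double_zero (hq : ContinuousOn q (Icc 0 1)) (h : IsShooting q Y Z) (μ : ℝ) :
    ∀ x ∈ Icc (0 : ℝ) 1, ¬ (Y μ x = 0 ∧ Z μ x = 0) :=
  (h.isSolPair μ).no_double_zero (hq.sub continuousOn_const) (by simp [h.right])

theorem eventually_dist_lt (hq : ContinuousOn q (Icc 0 1)) (h : IsShooting q Y Z) (μ : ℝ) {ε : ℝ}
    (hε : 0 < ε) : ∀ᶠ ν in 𝓝 μ, ∀ x ∈ Icc (0 : ℝ) 1, dist (Y μ x, Z μ x) (Y ν x, Z ν x) < ε := by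
  obtain ⟨K₀, hK₀⟩ := isCompact_Icc.exists_bound_of_continuousOn hq
  obtain ⟨B, hB⟩ := isCompact_Icc.exists_bound_of_continuousOn (h.isSolPair μ).continuousOn_left
  -- This bounds `|q - ν|` for every `ν` within distance `1` of `μ`.
  set K : ℝ := max 1 (K₀ + |μ| + 1)
  have hlim : Tendsto (fun ν => gronwallBound 0 K (|ν - μ| * |B|) 1) (𝓝 μ) (𝓝 0) := by
    have hc : Continuous fun ν => gronwallBound 0 K (|ν - μ| * |B|) 1 :=
      (gronwallBound_continuous_ε 0 K 1).comp (by fun_prop)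
    simpa [gronwallBound_ε0_δ0] using hc.tendsto μ
  filter_upwards [hlim.eventually (gt_mem_nhds hε), Metric.ball_mem_nhds μ one_pos] with ν hν hν1
    x hx
  rw [Metric.mem_ball, Real.dist_eq] at hν1
  rw [dist_comm]
  refine (IsSolPair.dist_le (h.isSolPair ν) (h.isSolPair μ) (by rw [h.left, h.left])
    (by rw [h.right, h.right]) (le_max_left _ _) (fun t ht => ?_) (fun t ht => ?_)
    (by positivity) x hx).trans_lt hν
  · refine le_trans ?_ (le_max_right _ _)
    have h1 := hK₀ t ht
    rw [Real.norm_eq_abs] at h1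
    have h2 := abs_sub (q t) ν
    have h3 : |ν| ≤ |ν - μ| + |μ| := by simpa using abs_add_le (ν - μ) μ
    linarith
  · have e : q t - μ - (q t - ν) = ν - μ := by ring
    rw [e]
    exact mul_le_mul_of_nonneg_left ((hB t ht).trans (le_abs_self B)) (abs_nonneg _)

theorem tendstoUniformlyOn_left (hq : ContinuousOn q (Icc 0 1)) (h : IsShooting q Y Z) (μ : ℝ) :
    TendstoUniformlyOn Y (Y μ) (𝓝 μ) (Icc 0 1) :=
  Metric.tendstoUniformlyOn_iff.2 fun _ hε =>
    (h.eventually_dist_lt hq μ hε).mono fun _ hν x hx => (le_max_left _ _).trans_lt (hν x hx)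

theorem tendstoUniformlyOn_right (hq : ContinuousOn q (Icc 0 1)) (h : IsShooting q Y Z) (μ : ℝ) :
    TendstoUniformlyOn Z (Z μ) (𝓝 μ) (Icc 0 1) :=
  Metric.tendstoUniformlyOn_iff.2 fun _ hε =>
    (h.eventually_dist_lt hq μ hε).mono fun _ hν x hx => (le_max_right _ _).trans_lt (hν x hx)

theorem isOpen_setOf_hasZeros (hq : ContinuousOn q (Icc 0 1)) (h : IsShooting q Y Z) (m : ℕ) :
    IsOpen {μ | HasZeros (Y μ) (Ioo 0 1) m} := by
  rw [isOpen_iff_mem_nhds]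
  intro μ hμ
  exact HasZeros.eventually (g := Z μ)
    (fun x hx => ((h.isSolPair μ).left x (Ioo_subset_Icc_self hx)).hasDerivAt
      (Icc_mem_nhds hx.1 hx.2))
    (fun x hx => h.no_double_zero hq μ x (Ioo_subset_Icc_self hx))
    (fun ν => (h.isSolPair ν).continuousOn_left.mono Ioo_subset_Icc_self)
    (fun x hx => (h.tendstoUniformlyOn_left hq μ).tendsto_at (Ioo_subset_Icc_self hx)) hμ

/-- There are no interior zeros when `μ < q` on `[0,1]`. -/
theorem not_hasZeros_one (hq : ContinuousOn q (Icc 0 1)) (h : IsShooting q Y Z) {μ : ℝ}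
    (hμ : ∀ x ∈ Icc (0 : ℝ) 1, μ ≤ q x) : ¬ HasZeros (Y μ) (Ioo 0 1) 1 := by
  rintro ⟨s, hs, hc, hz⟩
  obtain ⟨a, rfl⟩ := Finset.card_eq_one.1 hc
  have ha : a ∈ Ioo (0 : ℝ) 1 := hs (by simp)
  have hya : Y μ a = 0 := hz a (by simp)
  have hsol := h.isSolPair μ
  have hd : ∀ x ∈ Ioo (0 : ℝ) 1, HasDerivAt (Y μ) (Z μ x) x := fun x hx =>
    (hsol.left x (Ioo_subset_Icc_self hx)).hasDerivAt (Icc_mem_nhds hx.1 hx.2)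
  have hd' : ∀ x ∈ Ioo (0 : ℝ) 1, HasDerivAt (Z μ) ((q x - μ) * Y μ x) x := fun x hx =>
    (hsol.right x (Ioo_subset_Icc_self hx)).hasDerivAt (Icc_mem_nhds hx.1 hx.2)
  -- Here `(YZ)' = Z² + (q - μ) Y² ≥ 0`, so `YZ ≥ 0` and `Y²` is nondecreasing. A zero at `a` then
  -- forces `Y = 0` on `[0, a]`, against the absence of double zeros.
  have hmono : MonotoneOn (fun x => Y μ x * Z μ x) (Icc 0 1) := by
    refine monotoneOn_of_hasDerivWithinAt_nonneg (convex_Icc 0 1)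
      (hsol.continuousOn_left.mul hsol.continuousOn_right)
      (f' := fun x => Z μ x * Z μ x + Y μ x * ((q x - μ) * Y μ x)) ?_ ?_
    · intro x hx
      rw [interior_Icc] at hx ⊢
      exact ((hd x hx).mul (hd' x hx)).hasDerivWithinAt
    · intro x hx
      have := hμ x (interior_subset hx)
      nlinarith [mul_self_nonneg (Z μ x), mul_nonneg (sub_nonneg.2 this) (mul_self_nonneg (Y μ x))]
  have hnn : ∀ x ∈ Icc (0 : ℝ) 1, 0 ≤ Y μ x * Z μ x := fun x hx => by
    simpa [h.left] using hmono (by simp : (0 : ℝ) ∈ Icc (0 : ℝ) 1) hx hx.1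
  have hmono2 : MonotoneOn (fun x => Y μ x * Y μ x) (Icc 0 1) := by
    refine monotoneOn_of_hasDerivWithinAt_nonneg (convex_Icc 0 1)
      (hsol.continuousOn_left.mul hsol.continuousOn_left)
      (f' := fun x => Z μ x * Y μ x + Y μ x * Z μ x) ?_ ?_
    · intro x hx
      rw [interior_Icc] at hx ⊢
      exact ((hd x hx).mul (hd x hx)).hasDerivWithinAt
    · intro x hx
      have := hnn x (interior_subset hx)
      linarith [mul_comm (Y μ x) (Z μ x)]
  have hzero : ∀ x ∈ Icc 0 a, Y μ x = 0 := fun x hx => by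
    have := hmono2 ⟨hx.1, hx.2.trans ha.2.le⟩ (Ioo_subset_Icc_self ha) hx.2
    simp only [hya, mul_zero] at this
    exact mul_self_eq_zero.1 (le_antisymm this (mul_self_nonneg _))
  have hhalf : a / 2 ∈ Ioo 0 a := ⟨by linarith [ha.1], by linarith [ha.1]⟩
  have hhalf' : a / 2 ∈ Ioo (0 : ℝ) 1 := ⟨hhalf.1, hhalf.2.trans ha.2⟩
  have hev : Y μ =ᶠ[𝓝 (a / 2)] fun _ => 0 := by
    filter_upwards [Ioo_mem_nhds hhalf.1 hhalf.2] with t ht using hzero t (Ioo_subset_Icc_self ht)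
  have hZ : Z μ (a / 2) = 0 := by rw [← (hd _ hhalf').deriv, hev.deriv_eq, deriv_const]
  exact h.no_double_zero hq μ _ (Ioo_subset_Icc_self hhalf')
    ⟨hzero _ (Ioo_subset_Icc_self hhalf), hZ⟩

theorem bddBelow_setOf_hasZeros (hq : ContinuousOn q (Icc 0 1)) (h : IsShooting q Y Z) (m : ℕ) :
    BddBelow {μ | HasZeros (Y μ) (Ioo 0 1) (m + 1)} := by
  obtain ⟨K, hK⟩ := isCompact_Icc.exists_bound_of_continuousOn hq
  refine ⟨-K, fun μ hμ => ?_⟩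
  by_contra hlt
  refine h.not_hasZeros_one hq (fun x hx => ?_) (HasZeros.mono hμ (Nat.le_add_left 1 m))
  have := (abs_le.1 (hK x hx)).1
  linarith

/-- The threshold at which an `(m+1)`-st interior zero appears is an eigenvalue whose
eigenfunction has exactly `m` interior zeros. -/
theorem sInf_spec (hq : ContinuousOn q (Icc 0 1)) (h : IsShooting q Y Z) (m : ℕ)
    (hne : {μ | HasZeros (Y μ) (Ioo 0 1) (m + 1)}.Nonempty) :
    let μ := sInf {μ | HasZeros (Y μ) (Ioo 0 1) (m + 1)}
    Y μ 1 = 0 ∧ HasZeros (Y μ) (Ioo 0 1) m ∧ ¬ HasZeros (Y μ) (Ioo 0 1) (m + 1) := by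
  intro μ
  have hbdd := h.bddBelow_setOf_hasZeros hq m
  -- An open set bounded below does not contain its infimum.
  have hnot : ¬ HasZeros (Y μ) (Ioo 0 1) (m + 1) := by
    intro hμ
    obtain ⟨l, hl, hsub⟩ := exists_Ioc_subset_of_mem_nhds
      ((h.isOpen_setOf_hasZeros hq (m + 1)).mem_nhds hμ) ⟨μ - 1, by linarith⟩
    have : (l + μ) / 2 ∈ {μ | HasZeros (Y μ) (Ioo 0 1) (m + 1)} :=
      hsub ⟨by linarith, by linarith⟩
    have := csInf_le hbdd this
    change μ ≤ _ at this
    linarith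
  obtain ⟨ν, -, hν, hmem⟩ := exists_seq_tendsto_sInf hne hbdd
  -- The `m + 1` interior zeros along the sequence, together with the zero at `0`, all survive in
  -- the limit.
  have hlim : HasZeros (Y μ) (Icc 0 1) (m + 2) :=
    HasZeros.of_tendstoUniformlyOn (g := Z μ) (F := fun n => Y (ν n)) (G := fun n => Z (ν n))
      (fun n => (h.isSolPair (ν n)).left) (h.isSolPair μ).continuousOn_left
      (h.isSolPair μ).continuousOn_right
      (fun u hu => hν.eventually (h.tendstoUniformlyOn_left hq μ u hu))
      (fun u hu => hν.eventually (h.tendstoUniformlyOn_right hq μ u hu))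
      (h.no_double_zero hq μ) (fun n => HasZeros.Icc_of_Ioo (hmem n) (h.left _))
  refine ⟨?_, hlim.Ioo_of_Icc, hnot⟩
  -- If `Y μ 1 ≠ 0`, only the zero at `0` is discarded and `m + 1` interior zeros remain, which
  -- `hnot` excludes.
  by_contra h1
  exact hnot (hlim.Ioo_of_Icc_of_ne h1)

end IsShooting

/-- Sturm's oscillation theorem, upper bound: the eigenfunction of the `j`-th eigenvalue (counted
from `0`) has at most `j` zeros in `]0,1[`. -/
theorem IsDirichletEigenSystem.not_hasZeros {q : ℝ → ℝ} {lam : ℕ → ℝ} {h : ℕ → ℝ → ℝ}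
    (hq : ContinuousOn q (Icc 0 1)) (hE : IsDirichletEigenSystem q lam h) (j : ℕ) :
    ¬ HasZeros (h j) (Ioo 0 1) (j + 1) := by
  intro hz
  obtain ⟨Y, Z, hS⟩ := exists_isShooting hq
  have hsol := (hE.eigenpair j).isSolPair hq
  have hne := (hE.eigenpair j).derivWithin_zero_ne hq
  set c := derivWithin (h j) (Icc 0 1) 0
  have heq : ∀ x ∈ Icc (0 : ℝ) 1, h j x = c * Y (lam j) x := fun x hx =>
    (hsol.unique (hq.sub continuousOn_const) ((hS.isSolPair (lam j)).const_mul c) (x₀ := 0)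
      (by simp) (by simp [hS.left, (hE.eigenpair j).left]) (by simp [hS.right, c]) x hx).1
  have hmem : HasZeros (Y (lam j)) (Ioo 0 1) (j + 1) := hz.congr fun x hx h0 => by
    rw [heq x (Ioo_subset_Icc_self hx)] at h0
    exact (mul_eq_zero.1 h0).resolve_left hne
  set A : ℕ → Set ℝ := fun m => {μ | HasZeros (Y μ) (Ioo 0 1) (m + 1)}
  have hA : ∀ m ∈ Finset.range (j + 1), lam j ∈ A m := fun m hm =>
    HasZeros.mono hmem (by simpa using Finset.mem_range.1 hm)
  -- Each of the `j + 1` thresholds is an eigenvalue strictly below `lam j`. They are distinct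
  -- because their eigenfunctions have different zero counts, yet only `j` eigenvalues are
  -- available.
  have key : ∀ m ∈ Finset.range (j + 1), ∃ i ∈ Finset.range j, lam i = sInf (A m) := by
    intro m hm
    obtain ⟨h1, -, h3⟩ := hS.sInf_spec hq m ⟨_, hA m hm⟩
    obtain ⟨i, hi⟩ := hE.exhaustive _ _ ((hS.isSolPair _).isDirichletEigenpair hq (hS.left _) h1
      (by simp [hS.right]))
    refine ⟨i, Finset.mem_range.2 (hE.strictMono.lt_iff_lt.1 ?_), hi⟩
    rw [hi]
    refine lt_of_le_of_ne (csInf_le (hS.bddBelow_setOf_hasZeros hq m) (hA m hm)) fun heq => h3 ?_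
    change HasZeros (Y (sInf (A m))) _ _
    rw [show sInf (A m) = lam j from heq]
    exact hA m hm
  choose! i hi hlam using key
  have hlt : ∀ m ∈ Finset.range (j + 1), ∀ m' ∈ Finset.range (j + 1), m < m' → i m ≠ i m' := by
    intro m hm m' hm' hlt heq
    have e : sInf (A m) = sInf (A m') := by rw [← hlam m hm, ← hlam m' hm', heq]
    refine (hS.sInf_spec hq m ⟨_, hA m hm⟩).2.2 ?_
    change HasZeros (Y (sInf (A m))) _ _
    rw [e]
    exact (hS.sInf_spec hq m' ⟨_, hA m' hm'⟩).2.1.mono hlt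
  have := Finset.card_le_card_of_injOn i (s := Finset.range (j + 1)) (t := Finset.range j)
    (fun m hm => hi m hm) (fun m hm m' hm' heq => by
      rcases lt_trichotomy m m' with hl | hl | hl
      · exact absurd heq (hlt m hm m' hm' hl)
      · exact hl
      · exact absurd heq.symm (hlt m' hm' m hm hl))
  simp at this

/-! ### Zeros counted with multiplicity -/

/-- `f` has at least `N` zeros in `]0,1[`, counted with multiplicity. -/
def HasZerosMult (f : ℝ → ℝ) (N : ℕ) : Prop :=
  ∃ (s : Finset ℝ) (m : ℝ → ℕ), ↑s ⊆ Ioo (0 : ℝ) 1 ∧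
    (∀ x ∈ s, ∀ a < m x, iteratedDeriv a f x = 0) ∧ N ≤ ∑ x ∈ s, m x

/-- A point with `m x = 0` need not be a zero, so such points must go before Rolle's theorem counts
points. -/
theorem HasZerosMult.exists_pos {f : ℝ → ℝ} {N : ℕ} (h : HasZerosMult f N) :
    ∃ (s : Finset ℝ) (m : ℝ → ℕ), ↑s ⊆ Ioo (0 : ℝ) 1 ∧
    (∀ x ∈ s, ∀ a < m x, iteratedDeriv a f x = 0) ∧ N ≤ ∑ x ∈ s, m x ∧ ∀ x ∈ s, 0 < m x := by
  obtain ⟨s, m, hs, h0, hN⟩ := h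
  refine ⟨s.filter (fun x => m x ≠ 0), m, fun x hx => hs (Finset.mem_of_mem_filter x hx),
    fun x hx => h0 x (Finset.mem_of_mem_filter x hx), ?_,
    fun x hx => Nat.pos_of_ne_zero (Finset.mem_filter.1 hx).2⟩
  rwa [Finset.sum_filter_ne_zero]

/-- Rolle's theorem with multiplicities; `e` is a set of additional zeros at the endpoints. -/
theorem HasZerosMult.rolle {f : ℝ → ℝ} {N : ℕ} (h : HasZerosMult f N) {S : Set ℝ}
    (hS : S.OrdConnected) (hS1 : S ⊆ Icc 0 1) (hS0 : Ioo 0 1 ⊆ S) (hf : ContinuousOn f S)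
    {e : Finset ℝ} (heS : ↑e ⊆ S) (he : ∀ x ∈ e, x ∉ Ioo (0 : ℝ) 1) (he0 : ∀ x ∈ e, f x = 0) :
    HasZerosMult (deriv f) (N + e.card - 1) := by
  obtain ⟨s, m, hs, h0, hN, hpos⟩ := h.exists_pos
  set u := s ∪ e with hu
  have huS : ∀ x ∈ u, x ∈ S := fun x hx => by
    rcases Finset.mem_union.1 hx with hx | hx
    · exact hS0 (hs hx)
    · exact heS hx
  have hu0 : ∀ x ∈ u, f x = 0 := fun x hx => by
    rcases Finset.mem_union.1 hx with hx | hx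
    · simpa using h0 x hx 0 (hpos x hx)
    · exact he0 x hx
  have rolle : ∀ x y, x ∈ u ∧ y ∈ u ∧ x < y → ∃ c ∈ Ioo x y, deriv f c = 0 := fun x y h =>
    exists_deriv_eq_zero h.2.2 (hf.mono (hS.out (huS x h.1) (huS y h.2.1)))
      (by rw [hu0 x h.1, hu0 y h.2.1])
  choose! c hc hc0 using rolle
  set P := (u ×ˢ u).filter fun p => p.1 < p.2
  have hP : ∀ p ∈ P, p.1 ∈ u ∧ p.2 ∈ u ∧ p.1 < p.2 := fun p hp => by
    have := Finset.mem_filter.1 hp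
    exact ⟨(Finset.mem_product.1 this.1).1, (Finset.mem_product.1 this.1).2, this.2⟩
  set t := P.image fun p => c p.1 p.2
  -- Rolle points are chosen for all pairs, not only for neighbours; the interleaving bound then
  -- gives at least `u.card - 1` points outside `u`.
  have hcard : u.card ≤ (t \ u).card + 1 := by
    refine Finset.card_le_sdiff_of_interleaved fun x hx y hy hxy _ => ?_
    refine ⟨c x y, Finset.mem_image.2 ⟨(x, y), ?_, rfl⟩, hc x y ⟨hx, hy, hxy⟩⟩
    exact Finset.mem_filter.2 ⟨Finset.mem_product.2 ⟨hx, hy⟩, hxy⟩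
  have ht : ∀ x ∈ t, x ∈ Ioo (0 : ℝ) 1 ∧ deriv f x = 0 := fun x hx => by
    obtain ⟨p, hp, rfl⟩ := Finset.mem_image.1 hx
    have hp' := hP p hp
    have := hc _ _ hp'
    exact ⟨⟨(hS1 (huS _ hp'.1)).1.trans_lt this.1, this.2.trans_le (hS1 (huS _ hp'.2.1)).2⟩,
      hc0 _ _ hp'⟩
  have hdisj : Disjoint s e := Finset.disjoint_left.2 fun x hx hx' => he x hx' (hs hx)
  have hdisj' : Disjoint s (t \ u) := Finset.disjoint_left.2 fun x hx hx' =>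
    (Finset.mem_sdiff.1 hx').2 (Finset.mem_union_left _ hx)
  -- Old zeros lose one order and new ones count once. The total is at least `∑ m - |s| + (|s| + |e|
  -- - 1)`.
  refine ⟨s ∪ t \ u, fun x => if x ∈ s then m x - 1 else 1, ?_, ?_, ?_⟩
  · intro x hx
    rcases Finset.mem_union.1 (Finset.mem_coe.1 hx) with hx | hx
    · exact hs hx
    · exact (ht x (Finset.mem_sdiff.1 hx).1).1
  · intro x hx a ha
    by_cases hxs : x ∈ s
    · simp only [hxs, if_true] at ha
      rw [← iteratedDeriv_succ']
      exact h0 x hxs _ (by omega)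
    · simp only [hxs, if_false, Nat.lt_one_iff] at ha
      subst ha
      rw [iteratedDeriv_zero]
      exact (ht x (Finset.mem_sdiff.1 ((Finset.mem_union.1 hx).resolve_left hxs)).1).2
  · rw [Finset.sum_union hdisj']
    have e1 : ∑ x ∈ s, (if x ∈ s then m x - 1 else 1) + s.card = ∑ x ∈ s, m x := by
      rw [Finset.card_eq_sum_ones, ← Finset.sum_add_distrib]
      refine Finset.sum_congr rfl fun x hx => ?_
      rw [if_pos hx, Nat.sub_add_cancel (hpos x hx)]
    have e2 : ∑ x ∈ t \ u, (if x ∈ s then m x - 1 else 1) = (t \ u).card := by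
      rw [Finset.card_eq_sum_ones]
      exact Finset.sum_congr rfl fun x hx => if_neg (Finset.disjoint_right.1 hdisj' hx)
    have e3 : u.card = s.card + e.card := Finset.card_union_of_disjoint hdisj
    omega

/-- By Leibniz, a smooth factor preserves the order of vanishing. Equality on the open interval is
enough because derivatives are local. -/
theorem HasZerosMult.of_eq_mul {f g k : ℝ → ℝ} {N : ℕ} (h : HasZerosMult f N)
    (hf : ContDiffOn ℝ ∞ f (Ioo 0 1)) (hg : ContDiffOn ℝ ∞ g (Ioo 0 1))
    (hk : ∀ x ∈ Ioo (0 : ℝ) 1, k x = f x * g x) : HasZerosMult k N := by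
  obtain ⟨s, m, hs, h0, hN⟩ := h
  refine ⟨s, m, hs, fun x hx a ha => ?_, hN⟩
  have hx1 : Ioo (0 : ℝ) 1 ∈ 𝓝 x := Ioo_mem_nhds (hs hx).1 (hs hx).2
  have : k =ᶠ[𝓝 x] f * g := by filter_upwards [hx1] with y hy using hk y hy
  rw [this.iteratedDeriv_eq, iteratedDeriv_mul
    ((hf.contDiffAt hx1).of_le (mod_cast le_top)) ((hg.contDiffAt hx1).of_le (mod_cast le_top))]
  refine Finset.sum_eq_zero fun i hi => ?_
  rw [h0 x hx i (by have := Finset.mem_range.1 hi; omega)]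
  ring

theorem HasZerosMult.hasZeros {f : ℝ → ℝ} {N : ℕ} (h : HasZerosMult f N)
    (hd : ∀ x ∈ Ioo (0 : ℝ) 1, ¬ (f x = 0 ∧ deriv f x = 0)) : HasZeros f (Ioo 0 1) N := by
  obtain ⟨s, m, hs, h0, hN, hpos⟩ := h.exists_pos
  refine .of_le_card hs (hN.trans ?_) fun x hx => by simpa using h0 x hx 0 (hpos x hx)
  rw [Finset.card_eq_sum_ones]
  refine Finset.sum_le_sum fun x hx => ?_
  by_contra hlt
  exact hd x (hs hx) ⟨by simpa using h0 x hx 0 (by omega), by simpa using h0 x hx 1 (by omega)⟩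

/-! ### Linear combinations of eigenfunctions -/

/-- Bootstrap: `y' = z` and `z' = Q y` raise the regularity of the pair by one at each step. -/
theorem IsSolPair.contDiffOn {Q y z : ℝ → ℝ} (h : IsSolPair Q y z)
    (hQ : ContDiffOn ℝ ∞ Q (Ioo 0 1)) :
    ContDiffOn ℝ ∞ y (Ioo 0 1) ∧ ContDiffOn ℝ ∞ z (Ioo 0 1) := by
  have hy : ∀ x ∈ Ioo (0 : ℝ) 1, HasDerivAt y (z x) x := fun x hx =>
    (h.left x (Ioo_subset_Icc_self hx)).hasDerivAt (Icc_mem_nhds hx.1 hx.2)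
  have hz : ∀ x ∈ Ioo (0 : ℝ) 1, HasDerivAt z (Q x * y x) x := fun x hx =>
    (h.right x (Ioo_subset_Icc_self hx)).hasDerivAt (Icc_mem_nhds hx.1 hx.2)
  have key : ∀ n : ℕ, ContDiffOn ℝ n y (Ioo 0 1) ∧ ContDiffOn ℝ n z (Ioo 0 1) := by
    intro n
    induction n with
    | zero =>
      simp only [Nat.cast_zero, contDiffOn_zero]
      exact ⟨h.continuousOn_left.mono Ioo_subset_Icc_self,
        h.continuousOn_right.mono Ioo_subset_Icc_self⟩
    | succ n ih =>
      simp only [Nat.cast_succ, contDiffOn_succ_iff_deriv_of_isOpen isOpen_Ioo]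
      refine ⟨⟨fun x hx => (hy x hx).differentiableAt.differentiableWithinAt, by simp,
        ih.2.congr fun x hx => (hy x hx).deriv⟩,
        ⟨fun x hx => (hz x hx).differentiableAt.differentiableWithinAt, by simp, ?_⟩⟩
      exact ((hQ.of_le (mod_cast le_top)).mul ih.1).congr fun x hx => (hz x hx).deriv
  exact ⟨contDiffOn_infty.2 fun n => (key n).1, contDiffOn_infty.2 fun n => (key n).2⟩

/-- The linear combination `∑ v_i h_i`. -/
def linComb (h : ℕ → ℝ → ℝ) {n : ℕ} (v : Fin n → ℝ) (x : ℝ) : ℝ := ∑ i, v i * h i x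

section Sturm

variable {q : ℝ → ℝ} {lam : ℕ → ℝ} {h : ℕ → ℝ → ℝ} {n : ℕ}

theorem IsDirichletEigenSystem.contDiffOn (hE : IsDirichletEigenSystem q lam h)
    (hq : ContinuousOn q (Icc 0 1)) (hqs : ContDiffOn ℝ ∞ q (Ioo 0 1)) (i : ℕ) :
    ContDiffOn ℝ ∞ (h i) (Ioo 0 1) ∧ ContDiffOn ℝ ∞ (derivWithin (h i) (Icc 0 1)) (Ioo 0 1) :=
  ((hE.eigenpair i).isSolPair hq).contDiffOn (hqs.sub contDiffOn_const)

theorem contDiffOn_linComb {S : Set ℝ} (hs : ∀ i, ContDiffOn ℝ ∞ (h i) S) (v : Fin n → ℝ) :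
    ContDiffOn ℝ ∞ (linComb h v) S :=
  ContDiffOn.sum fun i _ => contDiffOn_const.mul (hs i)

theorem continuousOn_linComb {S : Set ℝ} (hs : ∀ i, ContinuousOn (h i) S) (v : Fin n → ℝ) :
    ContinuousOn (linComb h v) S :=
  continuousOn_finsetSum _ fun i _ => continuousOn_const.mul (hs i)

theorem hasDerivAt_linComb {h' : ℕ → ℝ → ℝ} {x : ℝ} (hd : ∀ i, HasDerivAt (h i) (h' i x) x)
    (v : Fin n → ℝ) : HasDerivAt (linComb h v) (linComb h' v x) x :=
  HasDerivAt.fun_sum fun i _ => (hd i).const_mul (v i)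

theorem hasDerivWithinAt_linComb {h' : ℕ → ℝ → ℝ} {x : ℝ} {S : Set ℝ}
    (hd : ∀ i, HasDerivWithinAt (h i) (h' i x) S x)
    (v : Fin n → ℝ) : HasDerivWithinAt (linComb h v) (linComb h' v x) S x :=
  HasDerivWithinAt.fun_sum fun i _ => (hd i).const_mul (v i)

/-- Liouville's step: applying the operator minus its first eigenvalue to a linear combination of
eigenfunctions does not decrease the number of zeros. -/
theorem IsDirichletEigenSystem.hasZerosMult_step (hE : IsDirichletEigenSystem q lam h)
    (hq : ContinuousOn q (Icc 0 1)) (hqs : ContDiffOn ℝ ∞ q (Ioo 0 1)) {v : Fin n → ℝ} {N : ℕ}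
    (hN : HasZerosMult (linComb h v) N) :
    HasZerosMult (linComb h fun i => (lam 0 - lam i) * v i) N := by
  have hsol := fun i => (hE.eigenpair i).isSolPair hq
  set g : ℕ → ℝ → ℝ := fun i => derivWithin (h i) (Icc 0 1)
  have hcd : ∀ i, ContDiffOn ℝ ∞ (h i) (Ioo 0 1) := fun i => (hE.contDiffOn hq hqs i).1
  have hcd' : ∀ i, ContDiffOn ℝ ∞ (g i) (Ioo 0 1) := fun i => (hE.contDiffOn hq hqs i).2
  have hd : ∀ i, ∀ x ∈ Ioo (0 : ℝ) 1, HasDerivAt (h i) (g i x) x := fun i x hx =>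
    ((hsol i).left x (Ioo_subset_Icc_self hx)).hasDerivAt (Icc_mem_nhds hx.1 hx.2)
  have hd' : ∀ i, ∀ x ∈ Ioo (0 : ℝ) 1, HasDerivAt (g i) ((q x - lam i) * h i x) x := fun i x hx =>
    ((hsol i).right x (Ioo_subset_Icc_self hx)).hasDerivAt (Icc_mem_nhds hx.1 hx.2)
  -- The oscillation bound for `j = 0` allows division by the ground state.
  have h0 : ∀ x ∈ Ioo (0 : ℝ) 1, h 0 x ≠ 0 := fun x hx hx0 =>
    hE.not_hasZeros hq 0 ⟨{x}, by simpa using hx, rfl, by simpa using hx0⟩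
  have hinv : ContDiffOn ℝ ∞ (fun x => (h 0 x)⁻¹) (Ioo 0 1) := (hcd 0).inv h0
  have hY := contDiffOn_linComb hcd v
  have hYg := contDiffOn_linComb hcd' v
  set R : ℝ → ℝ := fun x => linComb h v x * (h 0 x)⁻¹ with hR
  have hRs : ContDiffOn ℝ ∞ R (Ioo 0 1) := hY.mul hinv
  have z1 : HasZerosMult R N := hN.of_eq_mul hY hinv fun x _ => rfl
  have z2 : HasZerosMult (deriv R) (N - 1) := by
    simpa using z1.rolle ordConnected_Ioo Ioo_subset_Icc_self Subset.rfl hRs.continuousOn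
      (e := ∅) (by simp) (by simp) (by simp)
  -- The Wronskian `W = h₀² R'` is continuous up to the endpoints and vanishes there, unlike what is
  -- known of `R'`. These two extra zeros restore the count: `(N - 1) + 2 - 1 = N`.
  set W : ℝ → ℝ := fun x => h 0 x * linComb g v x - g 0 x * linComb h v x with hW
  have hWc : ContinuousOn W (Icc 0 1) :=
    ((hsol 0).continuousOn_left.mul
      (continuousOn_linComb (fun i => (hsol i).continuousOn_right) v)).sub
    ((hsol 0).continuousOn_right.mul
      (continuousOn_linComb (fun i => (hsol i).continuousOn_left) v))
  have hRd : ContDiffOn ℝ ∞ (deriv R) (Ioo 0 1) :=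
    (contDiffOn_infty_iff_deriv_of_isOpen isOpen_Ioo).1 hRs |>.2
  have z3 : HasZerosMult W (N - 1) := by
    refine z2.of_eq_mul (g := fun x => h 0 x * h 0 x) hRd ((hcd 0).mul (hcd 0)) fun x hx => ?_
    have := (hasDerivAt_linComb (fun i => hd i x hx) v).mul ((hd 0 x hx).inv (h0 x hx))
    have e : deriv R x = _ := this.deriv
    rw [e]
    simp only [hW, Pi.inv_apply]
    field_simp [h0 x hx]
    ring
  have hlz : ∀ x : ℝ, (∀ i, h i x = 0) → W x = 0 := fun x hx => by
    simp [hW, linComb, hx]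
  have z4 : HasZerosMult (deriv W) N := by
    have := z3.rolle ordConnected_Icc Subset.rfl Ioo_subset_Icc_self hWc (e := {0, 1})
      (by intro x hx; simp at hx; rcases hx with rfl | rfl <;> simp) (by simp)
      (by
        intro x hx
        simp only [Finset.mem_insert, Finset.mem_singleton] at hx
        rcases hx with rfl | rfl
        · exact hlz _ fun i => (hE.eigenpair i).left
        · exact hlz _ fun i => (hE.eigenpair i).right)
    rw [Finset.card_pair zero_ne_one] at this
    obtain ⟨s, m, a, b, c⟩ := this
    exact ⟨s, m, a, b, by omega⟩
  have hWs : ContDiffOn ℝ ∞ W (Ioo 0 1) := ((hcd 0).mul hYg).sub ((hcd' 0).mul hY)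
  have hWd : ContDiffOn ℝ ∞ (deriv W) (Ioo 0 1) :=
    (contDiffOn_infty_iff_deriv_of_isOpen isOpen_Ioo).1 hWs |>.2
  refine z4.of_eq_mul (g := fun x => (h 0 x)⁻¹) hWd hinv fun x hx => ?_
  -- The terms in `q` cancel, leaving `W' = h₀ ∑ (λ₀ - λ_i) v_i h_i`.
  have e : deriv W x = _ := (((hd 0 x hx).mul
    (hasDerivAt_linComb (h' := fun i x => (q x - lam i) * h i x) (fun i => hd' i x hx) v)).sub
    ((hd' 0 x hx).mul (hasDerivAt_linComb (fun i => hd i x hx) v))).deriv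
  rw [e, eq_mul_inv_iff_mul_eq₀ (h0 x hx)]
  simp only [linComb, Finset.sum_mul, Finset.mul_sum, ← Finset.sum_sub_distrib,
    ← Finset.sum_add_distrib]
  exact Finset.sum_congr rfl fun i _ => by ring

theorem IsDirichletEigenSystem.hasZerosMult_iterate (hE : IsDirichletEigenSystem q lam h)
    (hq : ContinuousOn q (Icc 0 1)) (hqs : ContDiffOn ℝ ∞ q (Ioo 0 1)) {v : Fin n → ℝ} {N : ℕ}
    (hN : HasZerosMult (linComb h v) N) (l : ℕ) :
    HasZerosMult (linComb h fun i => (lam 0 - lam i) ^ l * v i) N := by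
  induction l with
  | zero => simpa using hN
  | succ l ih =>
    have := hE.hasZerosMult_step hq hqs ih
    simpa only [pow_succ', mul_assoc] using this

theorem tendstoUniformlyOn_linComb {S : Set ℝ} (hb : ∀ i, ∃ B, ∀ x ∈ S, ‖h i x‖ ≤ B)
    {c : ℕ → Fin n → ℝ} {m : Fin n}
    (hc : ∀ i, Tendsto (fun l => c l i) atTop (𝓝 (if i = m then 1 else 0))) :
    TendstoUniformlyOn (fun l => linComb h (c l)) (h m) atTop S := by
  choose B hB using hb
  rw [Metric.tendstoUniformlyOn_iff]
  intro ε hε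
  have hlim : Tendsto (fun l => ∑ i : Fin n, |c l i - if i = m then 1 else 0| * B i) atTop
      (𝓝 0) := by
    have : Tendsto (fun l => ∑ i : Fin n, |c l i - if i = m then 1 else 0| * B i) atTop
        (𝓝 (∑ i : Fin n, |(if i = m then (1 : ℝ) else 0) - if i = m then 1 else 0| * B i)) :=
      tendsto_finsetSum _ fun i _ => (((hc i).sub_const _).abs).mul_const _
    simpa using this
  filter_upwards [hlim.eventually (gt_mem_nhds hε)] with l hl x hx
  refine lt_of_le_of_lt ?_ hl
  have e : h m x = ∑ i : Fin n, (if i = m then (1 : ℝ) else 0) * h i x := by simp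
  rw [dist_comm, Real.dist_eq, e, linComb, ← Finset.sum_sub_distrib]
  refine (Finset.abs_sum_le_sum_abs _ _).trans (Finset.sum_le_sum fun i _ => ?_)
  rw [← sub_mul, abs_mul]
  exact mul_le_mul_of_nonneg_left (hB i x hx) (abs_nonneg _)

/-- The combinations converge in `C¹` to `h m`, so their interior zeros are eventually simple, hence
distinct. With the endpoints this makes `n + 2` zeros, which pass to the limit and leave `h m` with
`n > m` interior zeros. -/
theorem IsDirichletEigenSystem.not_forall_hasZerosMult (hE : IsDirichletEigenSystem q lam h)
    (hq : ContinuousOn q (Icc 0 1)) {c : ℕ → Fin n → ℝ} {m : Fin n}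
    (hc : ∀ i, Tendsto (fun l => c l i) atTop (𝓝 (if i = m then 1 else 0))) :
    ¬ ∀ l, HasZerosMult (linComb h (c l)) n := by
  intro hN
  have hsol := fun i => (hE.eigenpair i).isSolPair hq
  set g : ℕ → ℝ → ℝ := fun i => derivWithin (h i) (Icc 0 1)
  have hF := tendstoUniformlyOn_linComb (h := h) (S := Icc 0 1) (fun i =>
    isCompact_Icc.exists_bound_of_continuousOn (hsol i).continuousOn_left) hc
  have hG := tendstoUniformlyOn_linComb (h := g) (S := Icc 0 1) (fun i =>
    isCompact_Icc.exists_bound_of_continuousOn (hsol i).continuousOn_right) hc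
  have hnd := (hsol m).no_double_zero (hq.sub continuousOn_const)
    ((hE.eigenpair m).derivWithin_zero_ne hq)
  have hd : ∀ l, ∀ x ∈ Icc (0 : ℝ) 1,
      HasDerivWithinAt (linComb h (c l)) (linComb g (c l) x) (Icc 0 1) x := fun l x hx =>
    hasDerivWithinAt_linComb (fun i => (hsol i).left x hx) _
  obtain ⟨L, hL⟩ := eventually_atTop.1 (eventually_no_double_zero (hsol m).continuousOn_left
    (hsol m).continuousOn_right hF hG hnd)
  have hz : ∀ l, HasZeros (linComb h (c (l + L))) (Icc 0 1) (n + 2) := fun l => by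
    refine ((hN (l + L)).hasZeros fun x hx => ?_).Icc_of_Ioo'
      (by simp [linComb, (hE.eigenpair _).left]) (by simp [linComb, (hE.eigenpair _).right])
    rw [((hd (l + L) x (Ioo_subset_Icc_self hx)).hasDerivAt (Icc_mem_nhds hx.1 hx.2)).deriv]
    exact hL _ (Nat.le_add_left _ _) x (Ioo_subset_Icc_self hx)
  have := HasZeros.of_tendstoUniformlyOn (fun l => hd (l + L)) (hsol m).continuousOn_left
    (hsol m).continuousOn_right
    (fun u hu => (tendsto_add_atTop_nat L).eventually (hF u hu))
    (fun u hu => (tendsto_add_atTop_nat L).eventually (hG u hu)) hnd hz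
  exact hE.not_hasZeros hq m (this.Ioo_of_Icc.mono m.2)

/-- Sturm's theorem: a nontrivial linear combination of the first `n` eigenfunctions has at most
`n - 1` zeros in `]0,1[`, counted with multiplicity. -/
theorem IsDirichletEigenSystem.eq_zero_of_hasZerosMult (hE : IsDirichletEigenSystem q lam h)
    (hq : ContinuousOn q (Icc 0 1)) (hqs : ContDiffOn ℝ ∞ q (Ioo 0 1)) {v : Fin n → ℝ}
    (hN : HasZerosMult (linComb h v) n) : v = 0 := by
  by_contra hv
  have hne : (Finset.univ.filter fun i => v i ≠ 0).Nonempty := by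
    obtain ⟨i, hi⟩ := Function.ne_iff.1 hv
    exact ⟨i, by simpa using hi⟩
  set m := (Finset.univ.filter fun i => v i ≠ 0).max' hne
  have hm : v m ≠ 0 := (Finset.mem_filter.1 (Finset.max'_mem _ hne)).2
  have hgt : ∀ i, m < i → v i = 0 := fun i hi => by
    by_contra h0
    exact absurd (Finset.le_max' _ i (by simpa using h0)) (not_le.2 hi)
  have hscale : ∀ (w : Fin n → ℝ) (a : ℝ), HasZerosMult (linComb h w) n →
      HasZerosMult (linComb h fun i => w i * a) n := fun w a hw =>
    hw.of_eq_mul (g := fun _ => a)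
      (contDiffOn_linComb (fun i => (hE.contDiffOn hq hqs i).1) w) contDiffOn_const fun x _ => by
        rw [linComb, linComb, Finset.sum_mul]
        exact Finset.sum_congr rfl fun i _ => by ring
  -- For `m = 0` the factor `lam 0 - lam m` vanishes and iteration is useless, but the combination
  -- is already a multiple of `h 0`.
  rcases Nat.eq_zero_or_pos (m : ℕ) with hm0 | hm0
  · refine hE.not_forall_hasZerosMult hq (c := fun _ i => v i * (v m)⁻¹) (m := m) (fun i => ?_)
      fun _ => hscale _ _ hN
    have : v i * (v m)⁻¹ = if i = m then 1 else 0 := by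
      split_ifs with hi
      · rw [hi, mul_inv_cancel₀ hm]
      · rw [hgt i (lt_of_le_of_ne (Fin.le_def.2 (by omega)) (Ne.symm hi)), zero_mul]
    rw [this]
    exact tendsto_const_nhds
  · have hD : ∀ i : Fin n, lam 0 - lam i ≤ 0 := fun i =>
      sub_nonpos.2 (hE.strictMono.monotone (Nat.zero_le _))
    have hDm : lam 0 - lam m < 0 := sub_neg.2 (hE.strictMono hm0)
    refine hE.not_forall_hasZerosMult hq
      (c := fun l i => (lam 0 - lam i) ^ l * v i * ((lam 0 - lam m) ^ l * v m)⁻¹) (m := m)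
      (fun i => ?_) fun l => hscale _ _ (hE.hasZerosMult_iterate hq hqs hN l)
    have e : (fun l : ℕ => (lam 0 - lam i) ^ l * v i * ((lam 0 - lam m) ^ l * v m)⁻¹)
        = fun l => ((lam 0 - lam i) / (lam 0 - lam m)) ^ l * (v i / v m) := by
      funext l
      rw [div_pow]
      field_simp
    -- For `i < m` the ratio lies in `[0, 1)`, so its powers tend to `0`; for `i > m` the
    -- coefficient is zero by the choice of `m`.
    rw [e]
    rcases lt_trichotomy i m with hi | hi | hi
    · rw [if_neg hi.ne]
      have hlt : (lam 0 - lam i) / (lam 0 - lam m) < 1 := by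
        rw [div_lt_one_of_neg hDm]
        have := hE.strictMono (show (i : ℕ) < m from hi)
        linarith
      simpa using (tendsto_pow_atTop_nhds_zero_of_lt_one (div_nonneg_of_nonpos (hD i) hDm.le)
        hlt).mul_const (v i / v m)
    · subst hi
      simp [div_self hDm.ne, div_self hm]
    · rw [if_neg hi.ne', hgt i hi]
      simp

end Sturm

/-- The confluent Slater determinant does not vanish. -/
theorem IsDirichletEigenSystem.det_iteratedDeriv_ne_zero {q : ℝ → ℝ} {lam : ℕ → ℝ}
    {h : ℕ → ℝ → ℝ} (hE : IsDirichletEigenSystem q lam h)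
    (hq : ContinuousOn q (Icc 0 1)) (hqs : ContDiffOn ℝ ∞ q (Ioo 0 1))
    {p : ℕ} (k : Fin p → ℕ) {cbar : Fin p → ℝ} (hinj : Function.Injective cbar)
    (hI : ∀ j, cbar j ∈ Ioo (0 : ℝ) 1) :
    (Matrix.of fun i b : Fin (∑ j, k j) =>
      iteratedDeriv ((finSigmaFinEquiv.symm b).2 : ℕ) (h i) (blockPoint k cbar b)).det ≠ 0 := by
  intro hdet
  -- A left kernel vector is a combination of the `h i` vanishing to order `k j` at each `cbar j`,
  -- and these orders add up to `n`.
  obtain ⟨v, hv, hv0⟩ := Matrix.exists_vecMul_eq_zero_iff.2 hdet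
  refine hv (hE.eq_zero_of_hasZerosMult hq hqs ?_)
  refine ⟨Finset.univ.image cbar, Function.extend cbar k 0, ?_, ?_, ?_⟩
  · intro x hx
    obtain ⟨j, _, rfl⟩ := Finset.mem_image.1 (Finset.mem_coe.1 hx)
    exact hI j
  · intro x hx a ha
    obtain ⟨j, _, rfl⟩ := Finset.mem_image.1 hx
    rw [hinj.extend_apply] at ha
    have := congrFun hv0 (finSigmaFinEquiv ⟨j, ⟨a, ha⟩⟩)
    simp only [Matrix.vecMul, dotProduct, Matrix.of_apply, Equiv.symm_apply_apply, blockPoint,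
      Pi.zero_apply] at this
    rw [← this]
    have hx1 : Ioo (0 : ℝ) 1 ∈ 𝓝 (cbar j) := Ioo_mem_nhds (hI j).1 (hI j).2
    have hcd : ∀ i : Fin (∑ j, k j), ContDiffAt ℝ a (h i) (cbar j) := fun i =>
      (((hE.contDiffOn hq hqs i).1).contDiffAt hx1).of_le (mod_cast le_top)
    unfold linComb
    rw [iteratedDeriv_fun_sum fun i _ => contDiffAt_const.mul (hcd i)]
    exact Finset.sum_congr rfl fun i _ => (iteratedDeriv_const_mul_field _ _).trans
      (by rw [Equiv.symm_apply_apply])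
  · rw [Finset.sum_image fun a _ b _ hab => hinj hab]
    simp [hinj.extend_apply]

/-! ### Newton interpolation -/

open Polynomial in
/-- The Newton polynomial `∏_{e < a} (x_e - X)`. -/
def newtonPoly {m : ℕ} (x : Fin m → ℝ) (a : Fin m) : ℝ[X] :=
  ∏ e ∈ Finset.Iio a, (Polynomial.C (x e) - Polynomial.X)

/-- The matrix of the Newton polynomials at the nodes. -/
def newtonMatrix {m : ℕ} (x : Fin m → ℝ) : Matrix (Fin m) (Fin m) ℝ :=
  Matrix.of fun a b => (newtonPoly x a).eval (x b)

/-- The factors `x e - X` reproduce `P_m` with its exact sign. The price is the leading coefficient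
`(-1)^a`, which reappears in `taylorMatrix`. -/
theorem newtonPoly_eq {m : ℕ} (x : Fin m → ℝ) (a : Fin m) :
    newtonPoly x a = Polynomial.C ((-1) ^ (a : ℕ)) *
      ∏ e ∈ Finset.Iio a, (Polynomial.X - Polynomial.C (x e)) := by
  have : ∀ e, Polynomial.C (x e) - Polynomial.X = -(Polynomial.X - Polynomial.C (x e)) :=
    fun e => (neg_sub _ _).symm
  simp only [newtonPoly, this, Finset.prod_neg, Fin.card_Iio]
  simp

theorem natDegree_newtonPoly_le {m : ℕ} (x : Fin m → ℝ) (a : Fin m) :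
    (newtonPoly x a).natDegree ≤ a := by
  rw [newtonPoly_eq]
  refine (Polynomial.natDegree_C_mul_le _ _).trans ?_
  rw [Polynomial.natDegree_finsetProd_X_sub_C_eq_card, Fin.card_Iio]

theorem coeff_newtonPoly {m : ℕ} (x : Fin m → ℝ) (a : Fin m) :
    (newtonPoly x a).coeff a = (-1) ^ (a : ℕ) := by
  rw [newtonPoly_eq, Polynomial.coeff_C_mul]
  have h1 : (∏ e ∈ Finset.Iio a, (Polynomial.X - Polynomial.C (x e))).natDegree
      = (a : ℕ) := by
    rw [Polynomial.natDegree_finsetProd_X_sub_C_eq_card, Fin.card_Iio]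
  have h2 := (Polynomial.monic_prod_X_sub_C x (Finset.Iio a)).coeff_natDegree
  rw [h1] at h2
  rw [h2, mul_one]

theorem newtonMatrix_apply {m : ℕ} (x : Fin m → ℝ) (a b : Fin m) :
    newtonMatrix x a b = ∏ e ∈ Finset.Iio a, (x e - x b) := by
  simp [newtonMatrix, newtonPoly, Polynomial.eval_prod]

theorem newtonMatrix_of_lt {m : ℕ} (x : Fin m → ℝ) {a b : Fin m} (h : b < a) :
    newtonMatrix x a b = 0 := by
  rw [newtonMatrix_apply]
  exact Finset.prod_eq_zero (Finset.mem_Iio.2 h) (sub_self _)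

theorem eval_vandermondePoly {m : ℕ} (x : Fin m → ℝ) :
    MvPolynomial.eval x (vandermondePoly m) = ∏ i, ∏ j ∈ Finset.Ioi i, (x i - x j) := by
  simp [vandermondePoly]

theorem det_newtonMatrix {m : ℕ} (x : Fin m → ℝ) :
    (newtonMatrix x).det = MvPolynomial.eval x (vandermondePoly m) := by
  have hu : (newtonMatrix x).IsUpperTriangular := fun a b h => newtonMatrix_of_lt x h
  rw [Matrix.det_of_isUpperTriangular hu, eval_vandermondePoly]
  simp only [newtonMatrix_apply]
  exact Finset.prod_comm' (by simp)

theorem eval_vandermondePoly_ne_zero_iff {m : ℕ} (x : Fin m → ℝ) :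
    MvPolynomial.eval x (vandermondePoly m) ≠ 0 ↔ Function.Injective x := by
  rw [eval_vandermondePoly, Finset.prod_ne_zero_iff]
  simp only [Finset.prod_ne_zero_iff, Finset.mem_univ, Finset.mem_Ioi, sub_ne_zero, true_imp_iff]
  refine ⟨fun h i j hij => ?_, fun h i j hij heq => hij.ne (h heq)⟩
  rcases lt_trichotomy i j with hl | hl | hl
  · exact absurd hij (h i j hl)
  · exact hl
  · exact absurd hij.symm (h j i hl)

/-! ### Iterated Rolle and divided differences -/

theorem HasZeros.deriv {f : ℝ → ℝ} {J : Set ℝ} {N : ℕ} (hJ : J.OrdConnected)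
    (hf : ContinuousOn f J) (h : HasZeros f J (N + 1)) : HasZeros (deriv f) J N := by
  obtain ⟨s, hs, hc, h0⟩ := h
  have rolle : ∀ x y, x ∈ s ∧ y ∈ s ∧ x < y → ∃ c ∈ Ioo x y, _root_.deriv f c = 0 :=
    fun x y h => exists_deriv_eq_zero h.2.2 (hf.mono (hJ.out (hs h.1) (hs h.2.1)))
      (by rw [h0 x h.1, h0 y h.2.1])
  choose! c hc' hc0 using rolle
  set P := (s ×ˢ s).filter fun p => p.1 < p.2
  have hP : ∀ p ∈ P, p.1 ∈ s ∧ p.2 ∈ s ∧ p.1 < p.2 := fun p hp => by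
    have := Finset.mem_filter.1 hp
    exact ⟨(Finset.mem_product.1 this.1).1, (Finset.mem_product.1 this.1).2, this.2⟩
  refine .of_le_card (s := P.image fun p => c p.1 p.2) ?_ ?_ ?_
  · intro x hx
    obtain ⟨p, hp, rfl⟩ := Finset.mem_image.1 (Finset.mem_coe.1 hx)
    exact hJ.out (hs (hP p hp).1) (hs (hP p hp).2.1) (Ioo_subset_Icc_self (hc' _ _ (hP p hp)))
  · have := Finset.card_le_of_interleaved (s := s) (t := P.image fun p => c p.1 p.2)
      fun x hx y hy hxy _ => ⟨c x y, Finset.mem_image.2 ⟨(x, y), Finset.mem_filter.2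
        ⟨Finset.mem_product.2 ⟨hx, hy⟩, hxy⟩, rfl⟩, hc' x y ⟨hx, hy, hxy⟩⟩
    omega
  · intro x hx
    obtain ⟨p, hp, rfl⟩ := Finset.mem_image.1 hx
    exact hc0 _ _ (hP p hp)

theorem HasZeros.exists_iteratedDeriv_eq_zero {J : Set ℝ} (hJ : J.OrdConnected) {a : ℕ} :
    ∀ {f : ℝ → ℝ}, (∀ i ≤ a, ContinuousOn (iteratedDeriv i f) J) → HasZeros f J (a + 1) →
      ∃ θ ∈ J, iteratedDeriv a f θ = 0 := by
  induction a with
  | zero =>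
    rintro f - ⟨s, hs, hc, h0⟩
    obtain ⟨θ, hθ⟩ := Finset.card_pos.1 (by omega : 0 < s.card)
    exact ⟨θ, hs hθ, by simpa using h0 θ hθ⟩
  | succ a ih =>
    intro f hf h
    rw [iteratedDeriv_succ']
    refine ih (fun i hi => ?_) (h.deriv hJ (by simpa using hf 0 (Nat.zero_le _)))
    rw [← iteratedDeriv_succ']
    exact hf _ (by omega)

theorem iteratedDeriv_eval (P : Polynomial ℝ) (a : ℕ) :
    iteratedDeriv a (fun x => P.eval x) = fun x => (Polynomial.derivative^[a] P).eval x := by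
  induction a generalizing P with
  | zero => simp
  | succ a ih =>
    rw [iteratedDeriv_succ', Function.iterate_succ_apply, ← ih]
    congr 1
    funext x
    exact P.deriv

theorem eval_iterate_derivative_of_natDegree_le {P : Polynomial ℝ} {a : ℕ} (h : P.natDegree ≤ a)
    (x : ℝ) : (Polynomial.derivative^[a] P).eval x = a.factorial * P.coeff a := by
  have hd : (Polynomial.derivative^[a] P).natDegree ≤ 0 :=
    (Polynomial.natDegree_iterate_derivative P a).trans (by omega)
  rw [Polynomial.eq_C_of_natDegree_le_zero hd, Polynomial.eval_C,
    Polynomial.coeff_iterate_derivative, zero_add, Nat.descFactorial_self, nsmul_eq_mul]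

theorem ContDiffOn.iteratedDeriv_of_isOpen {f : ℝ → ℝ} {I : Set ℝ} (hf : ContDiffOn ℝ ∞ f I)
    (hI : IsOpen I) (a : ℕ) : ContDiffOn ℝ ∞ (iteratedDeriv a f) I := by
  induction a with
  | zero => simpa using hf
  | succ a ih =>
    rw [iteratedDeriv_succ]
    exact ((contDiffOn_infty_iff_deriv_of_isOpen hI).1 ih).2

theorem ContDiffOn.hasDerivAt_iteratedDeriv {f : ℝ → ℝ} {I : Set ℝ} (hf : ContDiffOn ℝ ∞ f I)
    (hI : IsOpen I) (a : ℕ) {x : ℝ} (hx : x ∈ I) :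
    HasDerivAt (iteratedDeriv a f) (iteratedDeriv (a + 1) f x) x := by
  rw [iteratedDeriv_succ]
  exact (((hf.iteratedDeriv_of_isOpen hI a).contDiffAt (hI.mem_nhds hx)).differentiableAt
    (by simp)).hasDerivAt

/-- Newton's interpolation formula, the divided differences being expressed by the mean value
theorem. -/
theorem exists_newton_coeff {f : ℝ → ℝ} {I J : Set ℝ} (hI : IsOpen I) (hJ : J.OrdConnected)
    (hJI : J ⊆ I) (hf : ContDiffOn ℝ ∞ f I) {m : ℕ} {x : Fin m → ℝ} (hx : Function.Injective x)
    (hxJ : ∀ b, x b ∈ J) :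
    ∃ dd : Fin m → ℝ, (∀ b, f (x b) = ∑ a, dd a * newtonMatrix x a b) ∧
      ∀ a : Fin m, ∃ θ ∈ J, iteratedDeriv a f θ = a.val.factorial * (dd a * (-1) ^ (a : ℕ)) := by
  have hu : IsUnit (newtonMatrix x).det := by
    rw [det_newtonMatrix, isUnit_iff_ne_zero, eval_vandermondePoly_ne_zero_iff]
    exact hx
  set dd : Fin m → ℝ := Matrix.vecMul (fun b => f (x b)) (newtonMatrix x)⁻¹
  have hdd : ∀ b, f (x b) = ∑ a, dd a * newtonMatrix x a b := fun b => by
    have : Matrix.vecMul dd (newtonMatrix x) = fun b => f (x b) := by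
      rw [Matrix.vecMul_vecMul, Matrix.nonsing_inv_mul _ hu, Matrix.vecMul_one]
    exact (congrFun this b).symm
  refine ⟨dd, hdd, fun a => ?_⟩
  -- The truncated Newton sum interpolates `f` at the nodes of index `≤ a`, since later Newton
  -- polynomials vanish there. Thus `f - P` has `a + 1` zeros, while the `a`-th derivative of `P` is
  -- constant.
  set P : Polynomial ℝ := ∑ a' ∈ Finset.Iic a, Polynomial.C (dd a') * newtonPoly x a' with hP
  have hdeg : P.natDegree ≤ a := by
    refine Polynomial.natDegree_sum_le_of_forall_le _ _ fun a' ha' => ?_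
    exact ((Polynomial.natDegree_C_mul_le _ _).trans (natDegree_newtonPoly_le x a')).trans
      (Fin.le_def.1 (Finset.mem_Iic.1 ha'))
  have hcoeff : P.coeff a = dd a * (-1) ^ (a : ℕ) := by
    rw [hP, Polynomial.finsetSum_coeff, Finset.sum_eq_single a]
    · rw [Polynomial.coeff_C_mul, coeff_newtonPoly]
    · intro a' ha' hne
      rw [Polynomial.coeff_C_mul, Polynomial.coeff_eq_zero_of_natDegree_lt, mul_zero]
      exact (natDegree_newtonPoly_le x a').trans_lt
        (Fin.lt_def.1 (lt_of_le_of_ne (Finset.mem_Iic.1 ha') hne))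
    · simp
  have hcd : ∀ i : ℕ, ∀ t ∈ I, ContDiffAt ℝ i f t := fun i t ht =>
    (hf.contDiffAt (hI.mem_nhds ht)).of_le (mod_cast le_top)
  have hPs : ∀ (i : ℕ) (t : ℝ), ContDiffAt ℝ i (fun x => P.eval x) t := fun i t =>
    by
    simpa using (Polynomial.contDiff_aeval (𝕜 := ℝ) P i).contDiffAt (x := t)
  have hg : ∀ i : ℕ, ∀ t ∈ I, iteratedDeriv i (fun t => f t - P.eval t) t
      = iteratedDeriv i f t - (Polynomial.derivative^[i] P).eval t := fun i t ht => by
    rw [iteratedDeriv_fun_sub (hcd i t ht) (hPs i t), iteratedDeriv_eval]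
  have hcont : ∀ i : ℕ, ContinuousOn (iteratedDeriv i f) I := fun i =>
    (hf.iteratedDeriv_of_isOpen hI i).continuousOn
  have hz : HasZeros (fun t => f t - P.eval t) J (a + 1) := by
    refine ⟨(Finset.Iic a).image x, ?_, ?_, ?_⟩
    · intro t ht
      obtain ⟨b, _, rfl⟩ := Finset.mem_image.1 (Finset.mem_coe.1 ht)
      exact hxJ b
    · rw [Finset.card_image_of_injective _ hx, Fin.card_Iic]
    · intro t ht
      obtain ⟨b, hb, rfl⟩ := Finset.mem_image.1 ht
      rw [sub_eq_zero, hdd b, hP, Polynomial.eval_finsetSum]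
      symm
      rw [Finset.sum_subset (Finset.subset_univ (Finset.Iic a))]
      · simp [newtonMatrix]
      · intro a' _ ha'
        rw [Polynomial.eval_mul]
        have : Polynomial.eval (x b) (newtonPoly x a') = 0 :=
          newtonMatrix_of_lt x ((Finset.mem_Iic.1 hb).trans_lt (by simpa using ha'))
        rw [this, mul_zero]
  obtain ⟨θ, hθ, h0⟩ := hz.exists_iteratedDeriv_eq_zero hJ fun i _ =>
    (((hcont i).mono hJI).sub (Polynomial.derivative^[i] P).continuous.continuousOn).congr
      fun t ht => hg i t (hJI ht)
  refine ⟨θ, hθ, ?_⟩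
  rw [hg a θ (hJI hθ), eval_iterate_derivative_of_natDegree_le hdeg, hcoeff, sub_eq_zero] at h0
  exact h0

/-! ### Factorization of the Slater determinant -/

theorem Matrix.det_blockDiagonal_sigma {p : ℕ} {k : Fin p → ℕ}
    (N : ∀ j, Matrix (Fin (k j)) (Fin (k j)) ℝ) :
    (Matrix.blockDiagonal' N).det = ∏ j, (N j).det := by
  rw [(Matrix.blockTriangular_blockDiagonal' N).det_fintype]
  refine Finset.prod_congr rfl fun j _ => ?_
  rw [← Matrix.det_submatrix_equiv_self (Equiv.sigmaSubtype j).symm]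
  congr 1
  ext a b
  simp [Matrix.toSquareBlock, Matrix.toSquareBlockProp, Equiv.sigmaSubtype]

theorem Matrix.det_sub_isBigO {n : ℕ} (A₀ : Fin n → Fin n → ℝ) :
    (fun A : Fin n → Fin n → ℝ => (Matrix.of A).det - (Matrix.of A₀).det)
      =O[𝓝 A₀] fun A => A - A₀ := by
  have : Differentiable ℝ fun A : Fin n → Fin n → ℝ => (Matrix.of A).det := by
    simp only [Matrix.det_apply, Matrix.of_apply]
    fun_prop
  exact (this A₀).isBigO_sub

/-- The Vandermonde product of the blocks of `ξ`. -/
def vandermondeProd {p : ℕ} (k : Fin p → ℕ) (ξ : Fin (∑ j, k j) → ℝ) : ℝ :=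
  ∏ j, MvPolynomial.eval (block k ξ j) (vandermondePoly (k j))

/-- The matrix of the Taylor coefficients of the `h_i` at the `cbar j`, with alternating signs. -/
def taylorMatrix {p : ℕ} (k : Fin p → ℕ) (cbar : Fin p → ℝ) (h : ℕ → ℝ → ℝ)
    (i b : Fin (∑ j, k j)) : ℝ :=
  ((-1) ^ ((finSigmaFinEquiv.symm b).2 : ℕ) / ((finSigmaFinEquiv.symm b).2 : ℕ).factorial) *
    iteratedDeriv ((finSigmaFinEquiv.symm b).2 : ℕ) (h i) (blockPoint k cbar b)

section Factorization

variable {p : ℕ} {k : Fin p → ℕ} {cbar : Fin p → ℝ} {h : ℕ → ℝ → ℝ}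

theorem det_taylorMatrix_ne_zero
    (hdet : (Matrix.of fun i b : Fin (∑ j, k j) =>
      iteratedDeriv ((finSigmaFinEquiv.symm b).2 : ℕ) (h i) (blockPoint k cbar b)).det ≠ 0) :
    (Matrix.of (taylorMatrix k cbar h)).det ≠ 0 := by
  have := Matrix.det_mul_row (fun b : Fin (∑ j, k j) =>
    ((-1 : ℝ) ^ ((finSigmaFinEquiv.symm b).2 : ℕ) / ((finSigmaFinEquiv.symm b).2 : ℕ).factorial))
    (Matrix.of fun i b : Fin (∑ j, k j) =>
      iteratedDeriv ((finSigmaFinEquiv.symm b).2 : ℕ) (h i) (blockPoint k cbar b))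
  refine fun h0 => (mul_ne_zero (Finset.prod_ne_zero_iff.2 fun b _ => ?_) hdet)
    (this.symm.trans h0)
  exact div_ne_zero (pow_ne_zero _ (by norm_num)) (Nat.cast_ne_zero.2 (Nat.factorial_ne_zero _))

theorem slater_eq_zero_of_eq {n : ℕ} {x : Fin n → ℝ} {b b' : Fin n} (hne : b ≠ b')
    (hx : x b = x b') : slater h n x = 0 :=
  Matrix.det_zero_of_column_eq hne fun i => by simp [hx]

theorem blockPoint_add_apply (ξ : Fin (∑ j, k j) → ℝ) (j : Fin p) (a : Fin (k j)) :
    (blockPoint k cbar + ξ) (blockIndex k j a) = cbar j + block k ξ j a := by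
  simp [blockPoint, block, blockIndex]

theorem blockPoint_blockIndex (j : Fin p) (a : Fin (k j)) :
    blockPoint k cbar (blockIndex k j a) = cbar j := by
  simp [blockPoint, blockIndex]

theorem exists_blockIndex (b : Fin (∑ j, k j)) : ∃ j a, b = blockIndex k j a :=
  ⟨(finSigmaFinEquiv.symm b).1, (finSigmaFinEquiv.symm b).2, by simp [blockIndex]⟩

theorem taylorMatrix_blockIndex (i : Fin (∑ j, k j)) (j : Fin p) (a : Fin (k j)) :
    taylorMatrix k cbar h i (blockIndex k j a)
      = ((-1) ^ (a : ℕ) / (a : ℕ).factorial) * iteratedDeriv a (h i) (cbar j) := by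
  rw [taylorMatrix, blockPoint_blockIndex, blockIndex, Equiv.symm_apply_apply]

/-- This covers coincident nodes, where Newton interpolation is unavailable: two columns are equal.
-/
theorem slater_eq_zero_of_vandermondeProd {ξ : Fin (∑ j, k j) → ℝ} (hV : vandermondeProd k ξ = 0) :
    slater h _ (blockPoint k cbar + ξ) = 0 := by
  obtain ⟨j, -, hj⟩ := Finset.prod_eq_zero_iff.1 hV
  have : ¬ Function.Injective (block k ξ j) := fun hi =>
    (eval_vandermondePoly_ne_zero_iff _).2 hi hj
  rw [Function.Injective] at this
  push Not at this
  obtain ⟨a, a', heq, hne⟩ := this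
  refine slater_eq_zero_of_eq (b := blockIndex k j a) (b' := blockIndex k j a') ?_ ?_
  · intro hab
    have := finSigmaFinEquiv.injective hab
    simp only [Sigma.mk.injEq, heq_eq_eq, true_and] at this
    exact hne this
  · rw [blockPoint_add_apply, blockPoint_add_apply, heq]

/-- If the nodes of each block are distinct, the Slater determinant is the product of the
Vandermonde determinants of the blocks by a determinant of divided differences. -/
theorem exists_slater_eq_det_mul (hs : ∀ i, ContDiffOn ℝ ∞ (h i) (Ioo 0 1))
    {ξ : Fin (∑ j, k j) → ℝ} {r : ℝ} (hr : ∀ j, Icc (cbar j - r) (cbar j + r) ⊆ Ioo 0 1)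
    (hξ : ‖ξ‖ ≤ r) (hV : vandermondeProd k ξ ≠ 0) :
    ∃ A : Fin (∑ j, k j) → Fin (∑ j, k j) → ℝ,
      slater h _ (blockPoint k cbar + ξ) = (Matrix.of A).det * vandermondeProd k ξ ∧
      ∀ i j a, ∃ θ ∈ Icc (cbar j - r) (cbar j + r), A i (blockIndex k j a)
        = ((-1) ^ (a : ℕ) / (a : ℕ).factorial) * iteratedDeriv a (h i) θ := by
  have hinj : ∀ j, Function.Injective fun a => cbar j + block k ξ j a := fun j => by
    have := (eval_vandermondePoly_ne_zero_iff _).1 (Finset.prod_ne_zero_iff.1 hV j (Finset.mem_univ _))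
    exact fun a a' h => this (add_left_cancel h)
  have hmem : ∀ j a, cbar j + block k ξ j a ∈ Icc (cbar j - r) (cbar j + r) := fun j a => by
    have := abs_le.1 ((norm_le_pi_norm ξ (blockIndex k j a)).trans hξ)
    exact ⟨by simp only [block]; linarith [this.1], by simp only [block]; linarith [this.2]⟩
  have key := fun (i : Fin (∑ j, k j)) (j : Fin p) =>
    exists_newton_coeff isOpen_Ioo ordConnected_Icc (hr j) (hs i) (hinj j) (hmem j)
  choose dd hdd θ hθ hθd using key
  refine ⟨fun i b => dd i (finSigmaFinEquiv.symm b).1 (finSigmaFinEquiv.symm b).2, ?_, ?_⟩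
  · have hN : ∏ j, (newtonMatrix fun a => cbar j + block k ξ j a).det = vandermondeProd k ξ := by
      refine Finset.prod_congr rfl fun j _ => ?_
      rw [det_newtonMatrix, eval_vandermondePoly, eval_vandermondePoly]
      simp
    -- Newton's formula, read block by block, is the matrix identity "Slater matrix = divided
    -- differences × block diagonal of Newton matrices".
    rw [← hN, ← Matrix.det_blockDiagonal_sigma, slater,
      ← Matrix.det_submatrix_equiv_self finSigmaFinEquiv,
      ← Matrix.det_submatrix_equiv_self finSigmaFinEquiv (Matrix.of fun i b : Fin (∑ j, k j) =>
        dd i (finSigmaFinEquiv.symm b).1 (finSigmaFinEquiv.symm b).2), ← Matrix.det_mul]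
    congr 1
    ext s ⟨j, b⟩
    rw [Matrix.mul_apply, Fintype.sum_sigma]
    refine Eq.trans ?_ (Finset.sum_eq_single j ?_ ?_).symm
    · simp only [Matrix.submatrix_apply, Matrix.of_apply, Matrix.blockDiagonal'_apply_eq]
      have e := blockPoint_add_apply (cbar := cbar) ξ j b
      rw [blockIndex] at e
      rw [e, hdd]
      refine Finset.sum_congr rfl fun a _ => ?_
      rw [Equiv.symm_apply_apply]
    · intro j' _ hne
      refine Finset.sum_eq_zero fun a _ => ?_
      rw [Matrix.blockDiagonal'_apply_ne _ _ _ hne, mul_zero]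
    · simp
  · intro i j a
    refine ⟨θ i j a, hθ i j a, ?_⟩
    rw [hθd, blockIndex]
    beta_reduce
    rw [Equiv.symm_apply_apply]
    have h1 : ((a : ℕ).factorial : ℝ) ≠ 0 := Nat.cast_ne_zero.2 (Nat.factorial_ne_zero _)
    have h2 : ((-1 : ℝ) ^ (a : ℕ)) * (-1) ^ (a : ℕ) = 1 := by
      rw [← mul_pow]; norm_num
    field_simp
    linear_combination (-dd i j a) * h2

/-- The bound is uniform in `θ` because the mean value points are known only to lie in the interval.
-/
theorem exists_iteratedDeriv_sub_le (hs : ∀ i, ContDiffOn ℝ ∞ (h i) (Ioo 0 1)) (i a : ℕ) {c : ℝ}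
    (hc : c ∈ Ioo (0 : ℝ) 1) : ∃ C, ∀ᶠ r in 𝓝 (0 : ℝ), ∀ θ ∈ Icc (c - r) (c + r),
      |iteratedDeriv a (h i) θ - iteratedDeriv a (h i) c| ≤ C * r := by
  obtain ⟨C, hC0, hC⟩ :=
    ((hs i).hasDerivAt_iteratedDeriv isOpen_Ioo a hc).differentiableAt.isBigO_sub.exists_pos
  obtain ⟨δ, hδ, hball⟩ := Metric.eventually_nhds_iff.1 hC.bound
  refine ⟨C, ?_⟩
  filter_upwards [gt_mem_nhds hδ] with r hr θ hθ
  have hdist : |θ - c| ≤ r := abs_le.2 ⟨by linarith [hθ.1], by linarith [hθ.2]⟩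
  refine (hball (show dist θ c < δ from hdist.trans_lt hr)).trans ?_
  exact mul_le_mul_of_nonneg_left hdist hC0.le

/-- `𝔖_n(c + ξ) = ρ V(ξ) (1 + O(|ξ|))`. -/
theorem exists_slater_sub_le (hs : ∀ i, ContDiffOn ℝ ∞ (h i) (Ioo 0 1))
    (hI : ∀ j, cbar j ∈ Ioo (0 : ℝ) 1) :
    ∃ C, ∀ᶠ ξ in 𝓝 (0 : Fin (∑ j, k j) → ℝ),
      |slater h _ (blockPoint k cbar + ξ)
        - (Matrix.of (taylorMatrix k cbar h)).det * vandermondeProd k ξ|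
        ≤ C * ‖ξ‖ * |vandermondeProd k ξ| := by
  obtain ⟨C₁, hC₁, hdet⟩ := (Matrix.det_sub_isBigO (taylorMatrix k cbar h)).exists_pos
  choose C hC using fun (i : Fin (∑ j, k j)) (s : Σ j, Fin (k j)) =>
    exists_iteratedDeriv_sub_le hs i s.2 (hI s.1)
  set B : ℝ := ∑ i, ∑ s, |C i s| with hB
  have hCB : ∀ i s, |C i s| ≤ B := fun i s =>
    (Finset.single_le_sum (f := fun s => |C i s|) (fun _ _ => abs_nonneg _)
      (Finset.mem_univ s)).trans
    (Finset.single_le_sum (f := fun i => ∑ s, |C i s|)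
      (fun _ _ => Finset.sum_nonneg fun _ _ => abs_nonneg _) (Finset.mem_univ i))
  have hB0 : 0 ≤ B := Finset.sum_nonneg fun _ _ => Finset.sum_nonneg fun _ _ => abs_nonneg _
  obtain ⟨δ, hδ, hball⟩ := Metric.eventually_nhds_iff.1 hdet.bound
  have hr : ∀ᶠ r in 𝓝 (0 : ℝ), ∀ j, Icc (cbar j - r) (cbar j + r) ⊆ Ioo 0 1 := by
    rw [eventually_all]
    intro j
    filter_upwards [gt_mem_nhds (hI j).1, gt_mem_nhds (sub_pos.2 (hI j).2)] with r h1 h2 x hx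
    exact ⟨by linarith [hx.1], by linarith [hx.2]⟩
  have hC' : ∀ᶠ r in 𝓝 (0 : ℝ), ∀ (i : Fin (∑ j, k j)) (s : Σ j, Fin (k j)),
      ∀ θ ∈ Icc (cbar s.1 - r) (cbar s.1 + r),
      |iteratedDeriv s.2 (h i) θ - iteratedDeriv s.2 (h i) (cbar s.1)| ≤ C i s * r := by
    rw [eventually_all]
    intro i
    rw [eventually_all]
    exact hC i
  have hsmall : ∀ᶠ r in 𝓝 (0 : ℝ), B * r < δ := by
    have : Tendsto (fun r => B * r) (𝓝 0) (𝓝 0) := by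
      simpa using (continuous_const_mul B).tendsto 0
    exact this.eventually (gt_mem_nhds hδ)
  have hnorm : Tendsto (fun ξ : Fin (∑ j, k j) → ℝ => ‖ξ‖) (𝓝 0) (𝓝 0) := tendsto_norm_zero
  -- `C₁` is the linear error constant of the determinant at the Taylor matrix, and `B` dominates
  -- the constants of all its entries.
  refine ⟨C₁ * B, ?_⟩
  filter_upwards [hnorm.eventually hr, hnorm.eventually hC', hnorm.eventually hsmall] with ξ h1 h2 h3
  by_cases hV : vandermondeProd k ξ = 0
  · simp [slater_eq_zero_of_vandermondeProd hV, hV]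
  -- The radius is `‖ξ‖` itself, which makes the error linear in `‖ξ‖`.
  obtain ⟨A, hA, hθ⟩ := exists_slater_eq_det_mul hs h1 le_rfl hV
  rw [hA, ← sub_mul, abs_mul]
  refine mul_le_mul_of_nonneg_right ?_ (abs_nonneg _)
  have hdist : ‖A - taylorMatrix k cbar h‖ ≤ B * ‖ξ‖ := by
    refine (pi_norm_le_iff_of_nonneg (by positivity)).2 fun i =>
      (pi_norm_le_iff_of_nonneg (by positivity)).2 fun b => ?_
    obtain ⟨j, a, rfl⟩ := exists_blockIndex b
    obtain ⟨θ, hθ1, hθ2⟩ := hθ i j a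
    rw [Pi.sub_apply, Pi.sub_apply, hθ2, taylorMatrix_blockIndex, ← mul_sub, norm_mul]
    have hw : ‖(-1 : ℝ) ^ (a : ℕ) / (a : ℕ).factorial‖ ≤ 1 := by
      rw [norm_div, norm_pow, norm_neg, norm_one, one_pow, Real.norm_natCast]
      exact div_le_one_of_le₀ (by exact_mod_cast Nat.one_le_iff_ne_zero.2 (Nat.factorial_ne_zero _))
        (by positivity)
    refine (mul_le_of_le_one_left (norm_nonneg _) hw).trans ((h2 i ⟨j, a⟩ θ hθ1).trans ?_)
    exact mul_le_mul_of_nonneg_right ((le_abs_self _).trans (hCB i ⟨j, a⟩)) (norm_nonneg _)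
  have := hball (y := A) (by rw [dist_eq_norm]; exact hdist.trans_lt h3)
  rw [Real.norm_eq_abs] at this
  refine this.trans ?_
  rw [mul_assoc]
  exact mul_le_mul_of_nonneg_left hdist hC₁.le

end Factorization

/-! ### Homogeneous polynomials and leading terms -/

theorem MvPolynomial.IsHomogeneous.prod_pow_degree {n d : ℕ} {P : MvPolynomial (Fin n) ℝ}
    (hP : P.IsHomogeneous d) {m : Fin n →₀ ℕ} (hm : m ∈ P.support) (t : ℝ) :
    ∏ i, t ^ m i = t ^ d := by
  rw [Finset.prod_pow_eq_pow_sum, hP.degree_eq_sum_deg_support hm, ← Finsupp.degree_eq_sum]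
  rfl

theorem MvPolynomial.IsHomogeneous.eval_smul {n d : ℕ} {P : MvPolynomial (Fin n) ℝ}
    (hP : P.IsHomogeneous d) (t : ℝ) (ξ : Fin n → ℝ) :
    MvPolynomial.eval (t • ξ) P = t ^ d * MvPolynomial.eval ξ P := by
  rw [MvPolynomial.eval_eq', MvPolynomial.eval_eq', Finset.mul_sum]
  refine Finset.sum_congr rfl fun m hm => ?_
  simp only [Pi.smul_apply, smul_eq_mul, mul_pow, Finset.prod_mul_distrib, hP.prod_pow_degree hm]
  ring

theorem MvPolynomial.IsHomogeneous.exists_abs_eval_le {n d : ℕ} {P : MvPolynomial (Fin n) ℝ}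
    (hP : P.IsHomogeneous d) : ∃ C, 0 ≤ C ∧ ∀ ξ, |MvPolynomial.eval ξ P| ≤ C * ‖ξ‖ ^ d := by
  refine ⟨∑ m ∈ P.support, |P.coeff m|, Finset.sum_nonneg fun _ _ => abs_nonneg _, fun ξ => ?_⟩
  rw [MvPolynomial.eval_eq', Finset.sum_mul]
  refine (Finset.abs_sum_le_sum_abs _ _).trans (Finset.sum_le_sum fun m hm => ?_)
  rw [abs_mul, Finset.abs_prod, ← hP.prod_pow_degree hm]
  refine mul_le_mul_of_nonneg_left (Finset.prod_le_prod (fun _ _ => abs_nonneg _) fun i _ => ?_)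
    (abs_nonneg _)
  rw [abs_pow]
  exact pow_le_pow_left₀ (abs_nonneg _) (norm_le_pi_norm ξ i) _

namespace IsLeadingTerm

variable {n d d' : ℕ} {f : (Fin n → ℝ) → ℝ} {c : Fin n → ℝ} {P P' : MvPolynomial (Fin n) ℝ}

/-- The values of `P` are recovered as limits along lines; uniqueness and antisymmetry both follow
from this. -/
theorem tendsto (h : IsLeadingTerm f c d P) (ξ : Fin n → ℝ) :
    Tendsto (fun t : ℝ => f (c + t • ξ) / t ^ d) (𝓝[≠] 0) (𝓝 (MvPolynomial.eval ξ P)) := by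
  have h1 : (fun t : ℝ => f (c + t • ξ) / t ^ d - MvPolynomial.eval ξ P)
      =O[𝓝[≠] 0] fun t : ℝ => t := by
    have := ((h.remainder ξ).mono (nhdsWithin_le_nhds (s := {0}ᶜ))).mul
      (isBigO_refl (fun t : ℝ => (t ^ d)⁻¹) (𝓝[≠] 0))
    refine this.congr' ?_ ?_
    · filter_upwards [self_mem_nhdsWithin] with t ht
      have ht' : t ^ d ≠ 0 := pow_ne_zero _ ht
      rw [h.homogeneous.eval_smul]
      field_simp
    · filter_upwards [self_mem_nhdsWithin] with t ht
      have ht' : t ^ d ≠ 0 := pow_ne_zero _ ht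
      rw [pow_succ]
      field_simp
  have h2 : Tendsto (fun t : ℝ => t) (𝓝[≠] 0) (𝓝 0) := tendsto_id.mono_left nhdsWithin_le_nhds
  simpa using (h1.trans_tendsto h2).add_const (MvPolynomial.eval ξ P)

theorem not_lt (h : IsLeadingTerm f c d P) (h' : IsLeadingTerm f c d' P') : ¬ d < d' := by
  intro hlt
  refine h.ne_zero (MvPolynomial.funext fun ξ => ?_)
  have h2 : Tendsto (fun t : ℝ => t ^ (d' - d)) (𝓝[≠] 0) (𝓝 0) := by
    have := (continuous_pow (M := ℝ) (d' - d)).tendsto 0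
    rw [zero_pow (by omega)] at this
    exact this.mono_left nhdsWithin_le_nhds
  have h3 := (h'.tendsto ξ).mul h2
  rw [mul_zero] at h3
  rw [map_zero]
  refine tendsto_nhds_unique (h.tendsto ξ) (h3.congr' ?_)
  filter_upwards [self_mem_nhdsWithin] with t ht
  have e : t ^ d' = t ^ d * t ^ (d' - d) := by rw [← pow_add]; congr 1; omega
  have h1 : t ^ d ≠ 0 := pow_ne_zero _ ht
  have h2 : t ^ (d' - d) ≠ 0 := pow_ne_zero _ ht
  rw [e]
  field_simp

/-- The leading term is unique. -/
theorem unique (h : IsLeadingTerm f c d P) (h' : IsLeadingTerm f c d' P') : d = d' ∧ P = P' := by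
  obtain rfl : d = d' := le_antisymm (Nat.le_of_not_lt (h'.not_lt h)) (Nat.le_of_not_lt (h.not_lt h'))
  exact ⟨rfl, MvPolynomial.funext fun ξ => tendsto_nhds_unique (h.tendsto ξ) (h'.tendsto ξ)⟩

theorem of_isBigO (hP : P.IsHomogeneous d) (h0 : P ≠ 0)
    (h : (fun ξ => f (c + ξ) - MvPolynomial.eval ξ P) =O[𝓝 0] fun ξ => ‖ξ‖ ^ (d + 1)) :
    IsLeadingTerm f c d P := by
  refine ⟨hP, h0, fun ξ => ?_⟩
  have ht : Tendsto (fun t : ℝ => t • ξ) (𝓝 0) (𝓝 0) := by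
    have : Continuous fun t : ℝ => t • ξ := by fun_prop
    simpa using this.tendsto 0
  refine (h.comp_tendsto ht).trans (IsBigO.of_bound (‖ξ‖ ^ (d + 1)) (.of_forall fun t => ?_))
  simp only [Function.comp_apply, norm_smul, norm_pow, norm_mul, norm_norm]
  rw [mul_pow, mul_comm]

/-- The leading term inherits the antisymmetries that fix the base point. -/
theorem eval_comp_perm {h : ℕ → ℝ → ℝ} (hP : IsLeadingTerm (slater h n) c d P)
    (τ : Equiv.Perm (Fin n)) (hτ : ∀ i, c (τ i) = c i) (ξ : Fin n → ℝ) :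
    MvPolynomial.eval (fun i => ξ (τ i)) P
      = ((Equiv.Perm.sign τ : ℤ) : ℝ) * MvPolynomial.eval ξ P := by
  refine tendsto_nhds_unique (hP.tendsto fun i => ξ (τ i)) ?_
  refine ((hP.tendsto ξ).const_mul _).congr fun t => ?_
  have := Matrix.det_permute' τ (Matrix.of fun i j : Fin n => h (i : ℕ) ((c + t • ξ) j))
  rw [← mul_div_assoc]
  congr 1
  rw [slater, ← this, slater]
  congr 1
  ext i j
  simp [hτ]

end IsLeadingTerm

/-! ### The block Vandermonde polynomial -/

section BlockVandermonde

variable {p : ℕ} (k : Fin p → ℕ)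

theorem eval_blockVandermonde (ξ : Fin (∑ j, k j) → ℝ) :
    MvPolynomial.eval ξ (blockVandermonde k) = vandermondeProd k ξ := by
  simp only [blockVandermonde, vandermondeProd, map_prod, MvPolynomial.eval_rename]
  rfl

theorem isHomogeneous_vandermondePoly (m : ℕ) :
    (vandermondePoly m).IsHomogeneous (m * (m - 1) / 2) := by
  have h := MvPolynomial.IsHomogeneous.prod Finset.univ
    (fun i : Fin m => ∏ j ∈ Finset.Ioi i, (MvPolynomial.X i - MvPolynomial.X j :
      MvPolynomial (Fin m) ℝ)) (fun i => ∑ j ∈ Finset.Ioi i, 1) fun i _ =>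
    MvPolynomial.IsHomogeneous.prod _ _ _ fun j _ =>
      (MvPolynomial.isHomogeneous_X ℝ i).sub (MvPolynomial.isHomogeneous_X ℝ j)
  have e : ∑ i : Fin m, ∑ j ∈ Finset.Ioi i, 1 = m * (m - 1) / 2 := by
    rw [← Finset.sum_range_id, ← Finset.sum_range_reflect, ← Fin.sum_univ_eq_sum_range
      (fun i => m - 1 - i)]
    refine Finset.sum_congr rfl fun i _ => ?_
    rw [Finset.sum_const, Fin.card_Ioi, smul_eq_mul, mul_one]
  rw [← e]
  exact h

theorem isHomogeneous_blockVandermonde :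
    (blockVandermonde k).IsHomogeneous (∑ j, k j * (k j - 1) / 2) :=
  MvPolynomial.IsHomogeneous.prod _ _ _ fun j _ =>
    (isHomogeneous_vandermondePoly (k j)).rename_isHomogeneous

theorem blockIndex_injective (j : Fin p) : Function.Injective (blockIndex k j) := fun a a' h => by
  have := finSigmaFinEquiv.injective h
  simpa using this

theorem blockVandermonde_ne_zero : blockVandermonde k ≠ 0 := by
  intro h0
  -- At this point all coordinates are distinct, so no Vandermonde factor vanishes.
  have h1 := eval_blockVandermonde k fun i => (i : ℝ)
  rw [h0, map_zero] at h1
  refine absurd h1.symm (Finset.prod_ne_zero_iff.2 fun j _ => ?_)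
  rw [eval_vandermondePoly_ne_zero_iff]
  intro a a' haa
  exact blockIndex_injective k j (Fin.ext (by simpa [block] using haa))

theorem sum_range_card_le_sum (s : Finset ℕ) : ∑ i ∈ Finset.range s.card, i ≤ ∑ i ∈ s, i := by
  induction s using Finset.induction_on_max with
  | empty => simp
  | insert a s ha ih =>
    have hnot : a ∉ s := fun h => lt_irrefl _ (ha a h)
    have hle : s.card ≤ a := by
      simpa using Finset.card_le_card (fun x hx => Finset.mem_range.2 (ha x hx) :
        s ⊆ Finset.range a)
    rw [Finset.card_insert_of_notMem hnot, Finset.sum_range_succ, Finset.sum_insert hnot]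
    omega

/-- Applied to the exponents of a monomial inside one block, this gives the least degree of an
antisymmetric polynomial. -/
theorem sum_le_of_injective {m : ℕ} {g : Fin m → ℕ} (hg : Function.Injective g) :
    m * (m - 1) / 2 ≤ ∑ a, g a := by
  have := sum_range_card_le_sum (Finset.univ.image g)
  rwa [Finset.card_image_of_injective _ hg, Finset.card_fin, Finset.sum_range_id,
    Finset.sum_image fun a _ b _ h => hg h] at this

/-- A polynomial antisymmetric in each block, of degree less than that of the block Vandermonde
polynomial, vanishes. -/
theorem eq_zero_of_antisymmetric {Q : MvPolynomial (Fin (∑ j, k j)) ℝ} {D : ℕ}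
    (hQ : Q.IsHomogeneous D) (hD : D < ∑ j, k j * (k j - 1) / 2)
    (hanti : ∀ j a b, a ≠ b →
      MvPolynomial.rename (Equiv.swap (blockIndex k j a) (blockIndex k j b)) Q = -Q) :
    Q = 0 := by
  ext m
  rw [MvPolynomial.coeff_zero]
  by_contra hm
  -- If two exponents in a block agreed, their transposition would fix the monomial and negate its
  -- coefficient.
  have hinj : ∀ j, Function.Injective fun a => m (blockIndex k j a) := by
    intro j a b hab
    by_contra hne
    set τ := Equiv.swap (blockIndex k j a) (blockIndex k j b)
    have h1 := MvPolynomial.coeff_rename_mapDomain τ τ.injective Q m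
    have h2 : m.mapDomain τ = m := by
      ext i
      rw [← Finsupp.equivMapDomain_eq_mapDomain, Finsupp.equivMapDomain_apply, Equiv.symm_swap]
      rcases eq_or_ne i (blockIndex k j a) with rfl | h1
      · rw [Equiv.swap_apply_left]; exact hab.symm
      rcases eq_or_ne i (blockIndex k j b) with rfl | h2
      · rw [Equiv.swap_apply_right]; exact hab
      · rw [Equiv.swap_apply_of_ne_of_ne h1 h2]
    rw [h2, hanti j a b hne, MvPolynomial.coeff_neg] at h1
    exact hm (by linarith)
  have hdeg : D = m.degree := hQ.degree_eq_sum_deg_support (MvPolynomial.mem_support_iff.2 hm)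
  have : m.degree = ∑ j, ∑ a, m (blockIndex k j a) := by
    rw [Finsupp.degree_eq_sum, ← finSigmaFinEquiv.sum_comp, Fintype.sum_sigma]
    rfl
  have hle := Finset.sum_le_sum fun j (_ : j ∈ Finset.univ) => sum_le_of_injective (hinj j)
  omega

/-- The Laplacian commutes with permutations of the variables, so `ΔP` is again antisymmetric, with
degree below the minimum. -/
theorem isHarmonicPoly_of_antisymmetric {P : MvPolynomial (Fin (∑ j, k j)) ℝ}
    (hP : P.IsHomogeneous (∑ j, k j * (k j - 1) / 2))
    (hanti : ∀ j a b, a ≠ b →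
      MvPolynomial.rename (Equiv.swap (blockIndex k j a) (blockIndex k j b)) P = -P) :
    IsHarmonicPoly P := by
  -- In degree `0` the truncated subtraction would not lower the degree; there `P` is constant.
  rcases Nat.eq_zero_or_pos (∑ j, k j * (k j - 1) / 2) with h0 | h0
  · rw [h0, ← MvPolynomial.totalDegree_zero_iff_isHomogeneous,
      MvPolynomial.totalDegree_eq_zero_iff_eq_C] at hP
    rw [IsHarmonicPoly, hP]
    simp
  · refine eq_zero_of_antisymmetric k (D := ∑ j, k j * (k j - 1) / 2 - 1 - 1)
      (MvPolynomial.IsHomogeneous.sum _ _ _ fun i _ => hP.pderiv.pderiv) (by omega) ?_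
    intro j a b hab
    set τ := Equiv.swap (blockIndex k j a) (blockIndex k j b)
    have hr : ∀ i, MvPolynomial.rename τ (MvPolynomial.pderiv i (MvPolynomial.pderiv i P))
        = -MvPolynomial.pderiv (τ i) (MvPolynomial.pderiv (τ i) P) := fun i => by
      rw [← MvPolynomial.pderiv_rename τ.injective, ← MvPolynomial.pderiv_rename τ.injective,
        hanti j a b hab, map_neg, map_neg]
    rw [map_sum, Finset.sum_congr rfl fun i _ => hr i, Finset.sum_neg_distrib,
      Equiv.sum_comp τ fun i => MvPolynomial.pderiv i (MvPolynomial.pderiv i P)]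

end BlockVandermonde

/-! ### Mixed derivatives of the Slater determinant -/

/-- The Slater determinant with the `b`-th column differentiated `α b` times. -/
def slaterDeriv (h : ℕ → ℝ → ℝ) {n : ℕ} (α : Fin n → ℕ) (x : Fin n → ℝ) : ℝ :=
  Matrix.det (Matrix.of fun i j : Fin n => iteratedDeriv (α j) (h i) (x j))

theorem slaterDeriv_zero (h : ℕ → ℝ → ℝ) (n : ℕ) : slaterDeriv h (0 : Fin n → ℕ) = slater h n := by
  funext x
  simp [slaterDeriv, slater]

theorem isOpen_cube (n : ℕ) : IsOpen {x : Fin n → ℝ | ∀ b, x b ∈ Ioo (0 : ℝ) 1} := by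
  have : {x : Fin n → ℝ | ∀ b, x b ∈ Ioo (0 : ℝ) 1} = Set.pi univ fun _ => Ioo 0 1 := by
    ext; simp
  rw [this]
  exact isOpen_set_pi finite_univ fun _ _ => isOpen_Ioo

theorem partialDeriv_congr {n : ℕ} {f g : (Fin n → ℝ) → ℝ} {U : Set (Fin n → ℝ)} (hU : IsOpen U)
    (hfg : EqOn f g U) (b : Fin n) : EqOn (partialDeriv b f) (partialDeriv b g) U := by
  intro x hx
  have hc : Tendsto (fun t : ℝ => x + t • (Pi.single b 1 : Fin n → ℝ)) (𝓝 0) (𝓝 x) := by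
    have : Continuous fun t : ℝ => x + t • (Pi.single b 1 : Fin n → ℝ) := by fun_prop
    simpa using this.tendsto 0
  refine Filter.EventuallyEq.deriv_eq ?_
  filter_upwards [hc.eventually (hU.mem_nhds hx)] with t ht using hfg ht

section SlaterDeriv

variable {h : ℕ → ℝ → ℝ} {n : ℕ}

/-- Only column `b` depends on `x b`, and the cofactors along it stay constant. -/
theorem partialDeriv_slaterDeriv (hs : ∀ i, ContDiffOn ℝ ∞ (h i) (Ioo 0 1)) (α : Fin n → ℕ)
    (b : Fin n) {x : Fin n → ℝ} (hx : x b ∈ Ioo (0 : ℝ) 1) :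
    partialDeriv b (slaterDeriv h α) x = slaterDeriv h (α + Pi.single b 1) x := by
  set M : Matrix (Fin n) (Fin n) ℝ := Matrix.of fun i j => iteratedDeriv (α j) (h i) (x j) with hM
  have hcol : ∀ u : Fin n → ℝ, (M.updateCol b u).det = ∑ i, M.adjugate b i * u i := fun u => by
    rw [← Matrix.cramer_apply, Matrix.cramer_eq_adjugate_mulVec]
    rfl
  have e1 : ∀ t : ℝ, slaterDeriv h α (x + t • (Pi.single b 1 : Fin n → ℝ))
      = ∑ i, M.adjugate b i * iteratedDeriv (α b) (h i) (x b + t) := fun t => by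
    rw [← hcol, slaterDeriv]
    congr 1
    ext i j
    rcases eq_or_ne j b with rfl | hj
    · simp
    · simp [hj, hM]
  have e2 : slaterDeriv h (α + Pi.single b 1) x
      = ∑ i, M.adjugate b i * iteratedDeriv (α b + 1) (h i) (x b) := by
    rw [← hcol, slaterDeriv]
    congr 1
    ext i j
    rcases eq_or_ne j b with rfl | hj
    · simp
    · simp [hj, hM]
  rw [partialDeriv, lineDeriv, e2]
  simp only [e1]
  refine HasDerivAt.deriv (HasDerivAt.fun_sum fun i _ => HasDerivAt.const_mul _ ?_)
  have h1 := (hs i).hasDerivAt_iteratedDeriv isOpen_Ioo (α b) hx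
  have h2 : HasDerivAt (fun t : ℝ => x b + t) 1 0 := (hasDerivAt_id 0).const_add (x b)
  have h3 : HasDerivAt (iteratedDeriv (α b) (h i)) (iteratedDeriv (α b + 1) (h i) (x b))
    (x b + 0) := by rwa [add_zero]
  simpa [Function.comp_def] using h3.comp (0 : ℝ) h2

/-- `f` coincides on the open cube with a differentiated Slater determinant. -/
def EqSlaterDeriv (h : ℕ → ℝ → ℝ) {n : ℕ} (f : (Fin n → ℝ) → ℝ) (α : Fin n → ℕ) : Prop :=
  EqOn f (slaterDeriv h α) {x | ∀ b, x b ∈ Ioo (0 : ℝ) 1}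

/-- Equality on an open set, rather than at one point, is what can be differentiated again. -/
theorem EqSlaterDeriv.iterate (hs : ∀ i, ContDiffOn ℝ ∞ (h i) (Ioo 0 1))
    {f : (Fin n → ℝ) → ℝ} {α : Fin n → ℕ} (hf : EqSlaterDeriv h f α) (b : Fin n) (a : ℕ) :
    EqSlaterDeriv h ((partialDeriv b)^[a] f) (α + Pi.single b a) := by
  induction a with
  | zero => simpa using hf
  | succ a ih =>
    rw [Function.iterate_succ_apply', Pi.single_add, ← add_assoc]
    intro x hx
    rw [partialDeriv_congr (isOpen_cube n) ih b hx, partialDeriv_slaterDeriv hs _ _ (hx b)]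

theorem EqSlaterDeriv.foldl (hs : ∀ i, ContDiffOn ℝ ∞ (h i) (Ioo 0 1)) {m : ℕ}
    (e : Fin m → Fin n) (l : List (Fin m)) {f : (Fin n → ℝ) → ℝ} {α : Fin n → ℕ}
    (hf : EqSlaterDeriv h f α) :
    EqSlaterDeriv h (l.foldl (fun F a => (partialDeriv (e a))^[(a : ℕ)] F) f)
      (α + (l.map fun a => (Pi.single (e a) (a : ℕ) : Fin n → ℕ)).sum) := by
  induction l generalizing f α with
  | nil => simpa using hf
  | cons a l ih =>
    rw [List.foldl_cons, List.map_cons, List.sum_cons, ← add_assoc]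
    exact ih (hf.iterate hs _ _)

theorem EqSlaterDeriv.vandermondeD (hs : ∀ i, ContDiffOn ℝ ∞ (h i) (Ioo 0 1)) {m : ℕ}
    (e : Fin m → Fin n) {f : (Fin n → ℝ) → ℝ} {α : Fin n → ℕ} (hf : EqSlaterDeriv h f α) :
    EqSlaterDeriv h (vandermondeD e f) (α + ∑ a, Pi.single (e a) (a : ℕ)) := by
  rw [Fin.sum_univ_def]
  exact hf.foldl hs e _

theorem EqSlaterDeriv.foldr (hs : ∀ i, ContDiffOn ℝ ∞ (h i) (Ioo 0 1)) {p : ℕ} (k : Fin p → ℕ)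
    (l : List (Fin p)) {f : (Fin (∑ j, k j) → ℝ) → ℝ} {α : Fin (∑ j, k j) → ℕ}
    (hf : EqSlaterDeriv h f α) :
    EqSlaterDeriv h (l.foldr (fun j F => _root_.vandermondeD (blockIndex k j) F) f)
      (α + (l.map fun j => ∑ a, (Pi.single (blockIndex k j a) (a : ℕ) :
        Fin (∑ j, k j) → ℕ)).sum) := by
  induction l with
  | nil => simpa using hf
  | cons j l ih =>
    rw [List.foldr_cons, List.map_cons, List.sum_cons, add_left_comm, add_comm]
    exact ih.vandermondeD hs _

theorem sum_single_blockIndex {p : ℕ} (k : Fin p → ℕ) :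
    ∑ j, ∑ a, (Pi.single (blockIndex k j a) (a : ℕ) : Fin (∑ j, k j) → ℕ)
      = fun b => ((finSigmaFinEquiv.symm b).2 : ℕ) := by
  have h1 : ∑ j, ∑ a, (Pi.single (blockIndex k j a) (a : ℕ) : Fin (∑ j, k j) → ℕ)
      = ∑ b, Pi.single b ((finSigmaFinEquiv.symm b).2 : ℕ) := by
    rw [← finSigmaFinEquiv.sum_comp, Fintype.sum_sigma]
    refine Finset.sum_congr rfl fun j _ => Finset.sum_congr rfl fun a _ => ?_
    rw [Equiv.symm_apply_apply, blockIndex]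
  rw [h1, Finset.univ_sum_single]

/-- At `blockPoint k cbar` the right side is the determinant of `det_iteratedDeriv_ne_zero`. -/
theorem blockD_slater (hs : ∀ i, ContDiffOn ℝ ∞ (h i) (Ioo 0 1)) {p : ℕ} (k : Fin p → ℕ)
    {x : Fin (∑ j, k j) → ℝ} (hx : ∀ b, x b ∈ Ioo (0 : ℝ) 1) :
    blockD k (slater h (∑ j, k j)) x
      = slaterDeriv h (fun b => ((finSigmaFinEquiv.symm b).2 : ℕ)) x := by
  have h0 : EqSlaterDeriv h (slater h (∑ j, k j)) 0 := fun x _ => by rw [slaterDeriv_zero]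
  have := h0.foldr hs k (List.finRange p) hx
  rwa [zero_add, ← Fin.sum_univ_def, sum_single_blockIndex] at this

end SlaterDeriv

section Translation

variable {n : ℕ} (c : Fin n → ℝ)

theorem partialDeriv_iterate_translate (b : Fin n) (a : ℕ) (f : (Fin n → ℝ) → ℝ) :
    (partialDeriv b)^[a] (fun ξ => f (c + ξ)) = fun ξ => (partialDeriv b)^[a] f (c + ξ) := by
  induction a with
  | zero => rfl
  | succ a ih =>
    rw [Function.iterate_succ_apply', Function.iterate_succ_apply', ih]
    funext ξ
    simp only [partialDeriv, lineDeriv, add_assoc]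

theorem vandermondeD_translate {m : ℕ} (e : Fin m → Fin n) (f : (Fin n → ℝ) → ℝ) :
    vandermondeD e (fun ξ => f (c + ξ)) = fun ξ => vandermondeD e f (c + ξ) := by
  unfold vandermondeD
  generalize List.finRange m = l
  induction l generalizing f with
  | nil => rfl
  | cons a l ih => rw [List.foldl_cons, List.foldl_cons, partialDeriv_iterate_translate, ih]

theorem blockD_translate {p : ℕ} (k : Fin p → ℕ) (c : Fin (∑ j, k j) → ℝ)
    (f : (Fin (∑ j, k j) → ℝ) → ℝ) :
    blockD k (fun ξ => f (c + ξ)) = fun ξ => blockD k f (c + ξ) := by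
  unfold blockD
  induction List.finRange p with
  | nil => rfl
  | cons j l ih => rw [List.foldr_cons, List.foldr_cons, ih, vandermondeD_translate]

end Translation

theorem blockPoint_blockPerm {p : ℕ} (k : Fin p → ℕ) (cbar : Fin p → ℝ)
    (σ : ∀ j, Equiv.Perm (Fin (k j))) (i : Fin (∑ j, k j)) :
    blockPoint k cbar (blockPerm k σ i) = blockPoint k cbar i := by
  simp [blockPoint, blockPerm, Equiv.permCongr_apply]

theorem blockPoint_swap {p : ℕ} (k : Fin p → ℕ) (cbar : Fin p → ℝ) (j : Fin p) (a b : Fin (k j))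
    (i : Fin (∑ j, k j)) :
    blockPoint k cbar (Equiv.swap (blockIndex k j a) (blockIndex k j b) i)
      = blockPoint k cbar i := by
  rcases eq_or_ne i (blockIndex k j a) with rfl | h1
  · rw [Equiv.swap_apply_left, blockPoint_blockIndex, blockPoint_blockIndex]
  rcases eq_or_ne i (blockIndex k j b) with rfl | h2
  · rw [Equiv.swap_apply_right, blockPoint_blockIndex, blockPoint_blockIndex]
  · rw [Equiv.swap_apply_of_ne_of_ne h1 h2]

/-! ### The main theorem -/

theorem IsLeadingTerm.isHarmonicPoly {p : ℕ} {k : Fin p → ℕ} {cbar : Fin p → ℝ} {h : ℕ → ℝ → ℝ}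
    {P : MvPolynomial (Fin (∑ j, k j)) ℝ}
    (hP : IsLeadingTerm (slater h (∑ j, k j)) (blockPoint k cbar) (∑ j, k j * (k j - 1) / 2) P) :
    IsHarmonicPoly P := by
  refine isHarmonicPoly_of_antisymmetric k hP.homogeneous fun j a b hab => ?_
  refine MvPolynomial.funext fun ξ => ?_
  have := hP.eval_comp_perm _ (blockPoint_swap k cbar j a b) ξ
  rw [Equiv.Perm.sign_swap ((blockIndex_injective k j).ne hab)] at this
  rw [MvPolynomial.eval_rename, map_neg]
  simpa [Function.comp_def] using this

end

theorem lemma6p7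
    (q : ℝ → ℝ)
    (hq : ∃ U : Set ℝ, IsOpen U ∧ Icc (0 : ℝ) 1 ⊆ U ∧ ContDiffOn ℝ ∞ q U)
    (lam : ℕ → ℝ) (h : ℕ → ℝ → ℝ) (hE : IsDirichletEigenSystem q lam h)
    (p : ℕ) (hp : 0 < p) (k : Fin p → ℕ) (hk : ∀ j, 0 < k j)
    (cbar : Fin p → ℝ) (hmono : StrictMono cbar) (hI : ∀ j, cbar j ∈ Ioo (0 : ℝ) 1) :
    ∃ ρ : ℝ, ρ ≠ 0 ∧
      -- existence of the leading term, with a uniform remainder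
      (∃ (d : ℕ) (P : MvPolynomial (Fin (∑ j, k j)) ℝ),
        IsLeadingTerm (slater h (∑ j, k j)) (blockPoint k cbar) d P ∧
        (fun ξ : Fin (∑ j, k j) → ℝ =>
          slater h (∑ j, k j) (blockPoint k cbar + ξ) - MvPolynomial.eval ξ P)
          =O[𝓝 0] fun ξ => ‖ξ‖ ^ (d + 1)) ∧
      -- properties of the leading term
      (∀ (d : ℕ) (P : MvPolynomial (Fin (∑ j, k j)) ℝ),
        IsLeadingTerm (slater h (∑ j, k j)) (blockPoint k cbar) d P →
        IsHarmonicPoly P ∧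
        (∀ (σ : ∀ j, Equiv.Perm (Fin (k j))) (ξ : Fin (∑ j, k j) → ℝ),
          MvPolynomial.eval (fun i => ξ (blockPerm k σ i)) P
            = ((Equiv.Perm.sign (blockPerm k σ) : ℤ) : ℝ) * MvPolynomial.eval ξ P) ∧
        (∀ ξ : Fin (∑ j, k j) → ℝ,
          MvPolynomial.eval ξ P = 0 ↔
            ∏ j, MvPolynomial.eval (block k ξ j) (vandermondePoly (k j)) = 0) ∧
        P = MvPolynomial.C ρ * blockVandermonde k ∧
        d = ∑ j, k j * (k j - 1) / 2) ∧
      -- local factorization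
      (∃ w : (Fin (∑ j, k j) → ℝ) → ℝ, Tendsto w (𝓝 0) (𝓝 0) ∧
        ∀ ξ : Fin (∑ j, k j) → ℝ, (∀ i, blockPoint k cbar i + ξ i ∈ Ioo (0 : ℝ) 1) →
          slater h (∑ j, k j) (blockPoint k cbar + ξ)
            = ρ * (∏ j, MvPolynomial.eval (block k ξ j) (vandermondePoly (k j))) * (1 + w ξ)) ∧
      -- the mixed derivative
      blockD k (slater h (∑ j, k j)) (blockPoint k cbar)
        = blockD k (fun ξ => slater h (∑ j, k j) (blockPoint k cbar + ξ)) 0 ∧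
      blockD k (slater h (∑ j, k j)) (blockPoint k cbar) ≠ 0 := by
  obtain ⟨U, -, hU, hqU⟩ := hq
  have hqc : ContinuousOn q (Icc 0 1) := hqU.continuousOn.mono hU
  have hqs : ContDiffOn ℝ ∞ q (Ioo 0 1) := hqU.mono (Ioo_subset_Icc_self.trans hU)
  have hs : ∀ i, ContDiffOn ℝ ∞ (h i) (Ioo 0 1) := fun i => (hE.contDiffOn hqc hqs i).1
  have hdet := hE.det_iteratedDeriv_ne_zero hqc hqs k hmono.injective hI
  set ρ : ℝ := (Matrix.of (taylorMatrix k cbar h)).det with hρdef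
  have hρ : ρ ≠ 0 := det_taylorMatrix_ne_zero hdet
  obtain ⟨C, hC⟩ := exists_slater_sub_le (k := k) hs hI
  rw [← hρdef] at hC
  have hVhom := isHomogeneous_blockVandermonde k
  obtain ⟨B, hB0, hB⟩ := hVhom.exists_abs_eval_le
  have hbigO : (fun ξ : Fin (∑ j, k j) → ℝ => slater h (∑ j, k j) (blockPoint k cbar + ξ)
      - MvPolynomial.eval ξ (MvPolynomial.C ρ * blockVandermonde k))
      =O[𝓝 0] fun ξ => ‖ξ‖ ^ (∑ j, k j * (k j - 1) / 2 + 1) := by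
    refine IsBigO.of_bound (|C| * B) ?_
    filter_upwards [hC] with ξ hξ
    rw [map_mul, MvPolynomial.eval_C, eval_blockVandermonde, Real.norm_eq_abs]
    have h1 := hB ξ
    rw [eval_blockVandermonde] at h1
    rw [norm_pow, norm_norm]
    calc _ ≤ C * ‖ξ‖ * |vandermondeProd k ξ| := hξ
      _ ≤ |C| * ‖ξ‖ * (B * ‖ξ‖ ^ (∑ j, k j * (k j - 1) / 2)) := by
        gcongr
        exact le_abs_self C
      _ = _ := by ring
  have hlead : IsLeadingTerm (slater h (∑ j, k j)) (blockPoint k cbar)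
      (∑ j, k j * (k j - 1) / 2) (MvPolynomial.C ρ * blockVandermonde k) :=
    .of_isBigO (hVhom.C_mul ρ)
      (mul_ne_zero (by simpa using hρ) (blockVandermonde_ne_zero k)) hbigO
  refine ⟨ρ, hρ, ⟨_, _, hlead, hbigO⟩, ?_, ?_, ?_, ?_⟩
  · intro d P hP
    -- Uniqueness reduces an arbitrary leading term to the explicit one.
    obtain ⟨rfl, rfl⟩ := hP.unique hlead
    refine ⟨hP.isHarmonicPoly, fun σ ξ => hP.eval_comp_perm _ (blockPoint_blockPerm k cbar σ) ξ,
      fun ξ => ?_, rfl, rfl⟩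
    rw [map_mul, MvPolynomial.eval_C, eval_blockVandermonde, mul_eq_zero, or_iff_right hρ]
    rfl
  -- This is the relative error; the value where `V = 0` only has to be small, since both sides of
  -- the factorization vanish there.
  · refine ⟨fun ξ => if vandermondeProd k ξ = 0 then 0 else
      (slater h (∑ j, k j) (blockPoint k cbar + ξ) - ρ * vandermondeProd k ξ)
        / (ρ * vandermondeProd k ξ), ?_, fun ξ _ => ?_⟩
    · have hlim : Tendsto (fun ξ : Fin (∑ j, k j) → ℝ => |C| / |ρ| * ‖ξ‖) (𝓝 0) (𝓝 0) := by
        simpa using (tendsto_norm_zero (E := Fin (∑ j, k j) → ℝ)).const_mul (|C| / |ρ|)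
      refine squeeze_zero_norm' ?_ hlim
      filter_upwards [hC] with ξ hξ
      split_ifs with hV
      · rw [norm_zero]; positivity
      · rw [norm_div, norm_mul, Real.norm_eq_abs, Real.norm_eq_abs, Real.norm_eq_abs,
          div_le_iff₀ (by positivity)]
        have : |C| / |ρ| * ‖ξ‖ * (|ρ| * |vandermondeProd k ξ|)
            = |C| * ‖ξ‖ * |vandermondeProd k ξ| := by
          field_simp
        rw [this]
        refine hξ.trans ?_
        gcongr
        exact le_abs_self C
    · change _ = ρ * vandermondeProd k ξ * _
      beta_reduce
      split_ifs with hV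
      · rw [slater_eq_zero_of_vandermondeProd hV, hV]; ring
      · field_simp
        ring
  · rw [blockD_translate]
    beta_reduce
    rw [add_zero]
  · rw [blockD_slater hs k fun b => by exact hI _]
    exact hdet
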